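/- **Conventions.** Propositional formulas are built from variables $X_n$ ($n\in\mathbb N$) by negation, small (binary) conjunctions $\wedge$ and disjunctions $\vee$, and big conjunctions $\bigwedge$ and disjunctions $\bigvee$ of arbitrary finite sets of formulas. The depth of a formula is the maximum number of nested (small or big) conjunctions and disjunctions in it; its weft is the maximum number of nested big ones. For $t\le d$ let $\Omega_{t,d}$ be the set of formulas of weft at most $t$ and depth at most $d$. For $d\ge1$, let $\Gamma^-_{0,d}$ (resp. $\Delta^-_{0,d}$) be the set of iterated small conjunctions $((\lambda_1\wedge\lambda_2)\wedge\cdots)\wedge\lambda_r$ (resp. disjunctions) of $1\le r\le d$ negative literals $\lambda_i=\neg X_{n_i}$, and for $t\ge 0$ let $\Gamma^-_{t+1,d}$ be the set of all $\bigwedge\Pi$ with $\Pi\subseteq\Delta^-_{t,d}$ finite and $\Delta^-_{t+1,d}$ the set of all $\bigvee\Pi$ with $\Pi\subseteq\Gamma^-_{t,d}$ finite. The sets $\Gamma^+_{t,d}$, $\Delta^+_{t,d}$ are defined in the same way with positive literals $\lambda_i=X_{n_i}$. A parameterized problem is a set $Q\subseteq\Sigma^*\times\Pi^*$ with finite alphabets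 $\Sigma,\Pi$; in an instance $(x,y)$, $y$ is the parameter. An fpt-reduction from $Q\subseteq\Sigma^*\times\Pi^*$ to $Q'\subseteq\Sigma'^*\times\Pi'^*$ is a map $R:\Sigma^*\times\Pi^*\to\Sigma'^*\times\Pi'^*$ such that (1) $(x,y)\in Q\iff R(x,y)\in Q'$; (2) for some computable $g:\mathbb N\to\mathbb N$, $|y'|\le g(|y|)$ whenever $R(x,y)=(x',y')$; (3) $R$ is computed by an algorithm that takes at most $f(|y|)\cdot p(|x|)$ steps, for some computable $f:\mathbb N\to\mathbb N$ and some polynomial $p$. For a set $\Gamma$ of formulas, $\mathrm{WSat}(\Gamma)$ is the parameterized problem: given (an encoding of) a formula $\alpha\in\Gamma$ and the parameter $k\in\mathbb N$ (in binary), decide whether $\alpha$ is $k$-satisfiable, i.e. satisfied by an assignment to the variables of $\alpha$ that sets exactly $k$ of them to true. For $t\ge1$, $\mathrm W[t]$ is the class of all parameterized problems that are fpt-reducible to $\mathrm{WSat}(\Omega_{t,d})$ for some $d\ge t$. **Theorem.** For all $t,d\ge1$, $$\mathrm{WSat}(\Delta^-_{2t+1,d})\in\mathrm W[2t-1]\qquad\text{and}\qquad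 \mathrm{WSat}(\Delta^+_{2t+2,d})\in\mathrm W[2t].$$ -/

import Mathlib

/-! ### Propositional formulas -/

/-- Propositional formulas over the variables `X n`, `n : ℕ`, with small (binary) and big (finitary)
conjunctions and disjunctions. The finite set of arguments of a big connective is given by a list. -/
inductive Fml : Type
  | var : ℕ → Fml
  | neg : Fml → Fml
  | and : Fml → Fml → Fml
  | or : Fml → Fml → Fml
  | bigAnd : List Fml → Fml
  | bigOr : List Fml → Fml

namespace Fml

/-- `α.Sat S`: the assignment that makes exactly the variables in `S` true satisfies `α`. -/
def Sat (S : Finset ℕ) : Fml → Prop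
  | var n => n ∈ S
  | neg α => ¬ α.Sat S
  | and α β => α.Sat S ∧ β.Sat S
  | or α β => α.Sat S ∨ β.Sat S
  | bigAnd l => ∀ α ∈ l, α.Sat S
  | bigOr l => ∃ α, ∃ _ : α ∈ l, α.Sat S

/-- The set of variables occurring in a formula. -/
def vars : Fml → Finset ℕ
  | var n => {n}
  | neg α => α.vars
  | and α β => α.vars ∪ β.vars
  | or α β => α.vars ∪ β.vars
  | bigAnd l => (l.map vars).foldr (· ∪ ·) ∅
  | bigOr l => (l.map vars).foldr (· ∪ ·) ∅

/-- The maximum number of nested (big and small) conjunctions and disjunctions. -/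
def depth : Fml → ℕ
  | var _ => 0
  | neg α => α.depth
  | and α β => max α.depth β.depth + 1
  | or α β => max α.depth β.depth + 1
  | bigAnd l => (l.map depth).foldr max 0 + 1
  | bigOr l => (l.map depth).foldr max 0 + 1

/-- The maximum number of nested big conjunctions and big disjunctions. -/
def weft : Fml → ℕ
  | var _ => 0
  | neg α => α.weft
  | and α β => max α.weft β.weft
  | or α β => max α.weft β.weft
  | bigAnd l => (l.map weft).foldr max 0 + 1
  | bigOr l => (l.map weft).foldr max 0 + 1

/-- `α` is `k`-satisfiable: some assignment of weight `k` to the variables of `α` satisfies `α`. -/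
def KSat (α : Fml) (k : ℕ) : Prop :=
  ∃ S : Finset ℕ, S ⊆ α.vars ∧ S.card = k ∧ α.Sat S

/-- The string of a formula in prefix notation. The nine symbols are
`0 = ¬`, `1 = ∧`, `2 = ∨`, `3 = ⋀`, `4 = ⋁`, `5 = X`, `6 = end mark`, and `7`, `8` for the binary
digits zero and one. The index of a variable is written in binary, least significant digit first. -/
def encode : Fml → List (Fin 9)
  | var n => 5 :: n.bits.map (fun b => if b then 8 else 7) ++ [6]
  | neg α => 0 :: α.encode
  | and α β => 1 :: α.encode ++ β.encode
  | or α β => 2 :: α.encode ++ β.encode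
  | bigAnd l => 3 :: (l.map encode).flatten ++ [6]
  | bigOr l => 4 :: (l.map encode).flatten ++ [6]

end Fml

/-- Positive literals. -/
def posLit : Set Fml := {α | ∃ n, α = Fml.var n}

/-- Negative literals. -/
def negLit : Set Fml := {α | ∃ n, α = Fml.neg (Fml.var n)}

mutual

/-- The class `Γ_{t,d}` over a set `L` of admitted literals:
`Γ_{0,d}` consists of the iterated small conjunctions `((λ₁ ∧ λ₂) ∧ …) ∧ λᵣ`, `1 ≤ r ≤ d`, of literals
from `L`, and `Γ_{t+1,d}` of the big conjunctions of formulas in `Δ_{t,d}`. -/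
def GammaClass (L : Set Fml) (d : ℕ) : ℕ → Set Fml
  | 0 => {α | ∃ (l : Fml) (ls : List Fml), (∀ β ∈ l :: ls, β ∈ L) ∧ (l :: ls).length ≤ d ∧
      α = ls.foldl Fml.and l}
  | t + 1 => {α | ∃ l : List Fml, (∀ β ∈ l, β ∈ DeltaClass L d t) ∧ α = Fml.bigAnd l}

/-- The class `Δ_{t,d}` over a set `L` of admitted literals: dual to `GammaClass`. -/
def DeltaClass (L : Set Fml) (d : ℕ) : ℕ → Set Fml
  | 0 => {α | ∃ (l : Fml) (ls : List Fml), (∀ β ∈ l :: ls, β ∈ L) ∧ (l :: ls).length ≤ d ∧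
      α = ls.foldl Fml.or l}
  | t + 1 => {α | ∃ l : List Fml, (∀ β ∈ l, β ∈ GammaClass L d t) ∧ α = Fml.bigOr l}

end

/-- `Δ⁺_{t,d}`: all literals are positive. -/
def DeltaPos (t d : ℕ) : Set Fml := DeltaClass posLit d t

/-- `Δ⁻_{t,d}`: all literals are negative. -/
def DeltaNeg (t d : ℕ) : Set Fml := DeltaClass negLit d t

/-- `Ω_{t,d}`: the formulas of weft at most `t` and depth at most `d`. -/
def Omega (t d : ℕ) : Set Fml := {α | α.weft ≤ t ∧ α.depth ≤ d}

/-! ### Algorithms and running time -/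

/-- Binary trees, the data of the algorithms. -/
inductive Dat : Type
  | nil : Dat
  | cons : Dat → Dat → Dat

namespace Dat

def hd : Dat → Dat
  | nil => nil
  | cons u _ => u

def tl : Dat → Dat
  | nil => nil
  | cons _ v => v

/-- The number `n` in unary, which represents the `n`th letter of an alphabet. -/
def num : ℕ → Dat
  | 0 => nil
  | n + 1 => cons nil (num n)

/-- A string over the alphabet `Fin a`, as the list of its letters. -/
def str {a : ℕ} : List (Fin a) → Dat
  | [] => nil
  | c :: w => cons (num c) (str w)

/-- A pair of strings. -/
def pair {a b : ℕ} (w : List (Fin a) × List (Fin b)) : Dat := cons (str w.1) (str w.2)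

end Dat

/-- While programs over binary trees (the WHILE language of Jones). A program transforms the tree
in its store. The primitives inspect or build a single node; as in truth tests, `nil` means false. -/
inductive Prog : Type
  | nil : Prog
  | id : Prog
  | hd : Prog
  | tl : Prog
  | cons : Prog → Prog → Prog
  | seq : Prog → Prog → Prog
  | cond : Prog → Prog → Prog → Prog
  | loop : Prog → Prog → Prog

/-- `Prog.Runs P x y n`: on input `x` the program `P` halts with output `y` after `n` steps.
Each executed operation counts as one step. As a step inspects or creates at most one node
(subtrees are shared, never copied or compared), running times in this model agree with those
on multitape Turing machines and on random access machines up to polynomials. -/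
inductive Prog.Runs : Prog → Dat → Dat → ℕ → Prop
  | nil (x : Dat) : Prog.Runs .nil x .nil 1
  | id (x : Dat) : Prog.Runs .id x x 1
  | hd (x : Dat) : Prog.Runs .hd x x.hd 1
  | tl (x : Dat) : Prog.Runs .tl x x.tl 1
  | cons {f g : Prog} {x y z : Dat} {m n : ℕ} :
      Prog.Runs f x y m → Prog.Runs g x z n → Prog.Runs (.cons f g) x (.cons y z) (m + n + 1)
  | seq {f g : Prog} {x y z : Dat} {m n : ℕ} :
      Prog.Runs f x y m → Prog.Runs g y z n → Prog.Runs (.seq f g) x z (m + n + 1)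
  | condTrue {c f g : Prog} {x y u v : Dat} {m n : ℕ} :
      Prog.Runs c x (.cons u v) m → Prog.Runs f x y n → Prog.Runs (.cond c f g) x y (m + n + 1)
  | condFalse {c f g : Prog} {x y : Dat} {m n : ℕ} :
      Prog.Runs c x .nil m → Prog.Runs g x y n → Prog.Runs (.cond c f g) x y (m + n + 1)
  | loopDone {c f : Prog} {x : Dat} {m : ℕ} :
      Prog.Runs c x .nil m → Prog.Runs (.loop c f) x x (m + 1)
  | loopStep {c f : Prog} {x y z u v : Dat} {l m n : ℕ} :
      Prog.Runs c x (.cons u v) l → Prog.Runs f x y m → Prog.Runs (.loop c f) y z n →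
      Prog.Runs (.loop c f) x z (l + m + n + 1)

/-! ### Parameterized problems -/

/-- A parameterized problem `Q ⊆ Σ* × Π*`, with the finite alphabets `Σ = {0, …, a - 1}` and
`Π = {0, …, b - 1}`. -/
structure ParamProblem : Type where
  a : ℕ
  b : ℕ
  yes : Set (List (Fin a) × List (Fin b))

/-- `R` is computed by an algorithm in at most `f(|y|) · p(|x|)` steps, `f` computable and `p` a
polynomial. -/
def FptComputable {a b a' b' : ℕ}
    (R : List (Fin a) × List (Fin b) → List (Fin a') × List (Fin b')) : Prop :=
  ∃ (P : Prog) (f : ℕ → ℕ) (p : Polynomial ℕ), Computable f ∧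
    ∀ x y, ∃ n ≤ f y.length * p.eval x.length, P.Runs (Dat.pair (x, y)) (Dat.pair (R (x, y))) n

/-- `Q ≤^fpt Q'`: there is an fpt-reduction from `Q` to `Q'`. -/
def FptReducible (Q Q' : ParamProblem) : Prop :=
  ∃ R : List (Fin Q.a) × List (Fin Q.b) → List (Fin Q'.a) × List (Fin Q'.b),
    (∀ x y, (x, y) ∈ Q.yes ↔ R (x, y) ∈ Q'.yes) ∧
    (∃ g : ℕ → ℕ, Computable g ∧ ∀ x y, (R (x, y)).2.length ≤ g y.length) ∧
    FptComputable R

/-- `[C]^fpt`: the problems that are fpt-reducible to a problem in `C`. -/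
def fptClosure (C : Set ParamProblem) : Set ParamProblem :=
  {Q | ∃ Q' ∈ C, FptReducible Q Q'}

/-- `WSat(Γ)`: given a formula `α ∈ Γ` and the parameter `k` (in binary), decide whether `α` is
`k`-satisfiable. -/
def WSat (Γ : Set Fml) : ParamProblem where
  a := 9
  b := 2
  yes := {w | ∃ α ∈ Γ, ∃ k : ℕ, α.KSat k ∧
    w = (α.encode, k.bits.map (fun b => if b then 1 else 0))}

/-- The class `W[t]` of the W-hierarchy (for `t ≥ 1`). -/
def W (t : ℕ) : Set ParamProblem := fptClosure {Q | ∃ d, t ≤ d ∧ Q = WSat (Omega t d)}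

/-! ### Encoding data as binary trees -/

namespace Dat

/-- The number of inner nodes of a tree. -/
def size : Dat → ℕ
  | nil => 0
  | cons u v => u.size + v.size + 1

theorem num_injective : Function.Injective num := by
  intro m
  induction m with
  | zero => intro n h; cases n with
    | zero => rfl
    | succ n => simp [num] at h
  | succ m ih => intro n h; cases n with
    | zero => simp [num] at h
    | succ n => simp only [num, cons.injEq, true_and] at h; rw [ih h]

@[simp] theorem size_num (n : ℕ) : (num n).size = n := by
  induction n with
  | zero => rfl
  | succ n ih => simp [num, size, ih]

theorem size_hd_le (x : Dat) : x.hd.size ≤ x.size := by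
  cases x <;> simp [hd, size]; omega

theorem size_tl_le (x : Dat) : x.tl.size ≤ x.size := by
  cases x <;> simp [tl, size]; omega

noncomputable instance : DecidableEq Dat := Classical.decEq _

end Dat

/-- Types whose elements are represented by binary trees. -/
class DatEnc (α : Type) where
  enc : α → Dat
  inj : Function.Injective enc

namespace DatEnc

variable {α β : Type} [DatEnc α] [DatEnc β]

instance : DatEnc Dat := ⟨fun x => x, fun _ _ h => h⟩

instance : DatEnc ℕ := ⟨Dat.num, Dat.num_injective⟩

instance {n : ℕ} : DatEnc (Fin n) :=
  ⟨fun i => Dat.num i, fun _ _ h => Fin.ext (Dat.num_injective h)⟩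

instance : DatEnc Bool :=
  ⟨fun b => Dat.num b.toNat, fun a b h => by
    have := Dat.num_injective h
    cases a <;> cases b <;> simp_all⟩

instance : DatEnc (α × β) :=
  ⟨fun p => .cons (enc p.1) (enc p.2), fun p q h => by
    simp only [Dat.cons.injEq] at h
    exact Prod.ext (inj h.1) (inj h.2)⟩

def encList : List α → Dat
  | [] => .nil
  | a :: l => .cons (enc a) (encList l)

theorem encList_injective : Function.Injective (encList : List α → Dat) := by
  intro l
  induction l with
  | nil => intro m h; cases m with
    | nil => rfl
    | cons => simp [encList] at h
  | cons a l ih => intro m h; cases m with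
    | nil => simp [encList] at h
    | cons b m =>
      simp only [encList, Dat.cons.injEq] at h
      rw [inj h.1, ih h.2]

instance : DatEnc (List α) := ⟨encList, encList_injective⟩

/-- The size of the tree that represents `a`. -/
def sz (a : α) : ℕ := (enc a).size

@[simp] theorem enc_dat (x : Dat) : enc x = x := rfl
@[simp] theorem enc_nil : enc ([] : List α) = .nil := rfl
@[simp] theorem enc_cons (a : α) (l : List α) : enc (a :: l) = .cons (enc a) (enc l) := rfl
@[simp] theorem enc_pair (p : α × β) : enc p = .cons (enc p.1) (enc p.2) := rfl
@[simp] theorem enc_true : enc true = .cons .nil .nil := rfl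
@[simp] theorem enc_false : enc false = .nil := rfl
@[simp] theorem sz_nil : sz ([] : List α) = 0 := rfl
@[simp] theorem sz_cons (a : α) (l : List α) : sz (a :: l) = sz a + sz l + 1 := rfl
@[simp] theorem sz_pair (p : α × β) : sz p = sz p.1 + sz p.2 + 1 := rfl
@[simp] theorem sz_nat (n : ℕ) : sz n = n := Dat.size_num n
@[simp] theorem sz_fin {m : ℕ} (n : Fin m) : sz n = n := Dat.size_num n
@[simp] theorem sz_true : sz true = 1 := rfl
@[simp] theorem sz_false : sz false = 0 := rfl
theorem sz_bool_le (b : Bool) : sz b ≤ 1 := by cases b <;> simp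

theorem sz_append (l m : List α) : sz (l ++ m) = sz l + sz m := by
  induction l with
  | nil => simp
  | cons a l ih => simp [ih]; omega

theorem length_le_sz (l : List α) : l.length ≤ sz l := by
  induction l with
  | nil => simp
  | cons a l ih => simp; omega

theorem sz_le_of_mem {l : List α} {a : α} (h : a ∈ l) : sz a ≤ sz l := by
  induction l with
  | nil => simp at h
  | cons b l ih =>
    rcases List.mem_cons.1 h with rfl | h
    · simp; omega
    · have := ih h; simp; omega

theorem sz_le_of_forall {l : List α} {c : ℕ} (h : ∀ a ∈ l, sz a ≤ c) :
    sz l ≤ l.length * (c + 1) := by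
  induction l with
  | nil => simp
  | cons a l ih =>
    have h1 := h a (by simp)
    have h2 := ih fun b hb => h b (by simp [hb])
    simp only [sz_cons, List.length_cons, add_mul]
    omega

theorem enc_str {a : ℕ} (w : List (Fin a)) : Dat.str w = enc w := by
  induction w with
  | nil => rfl
  | cons c w ih => rw [Dat.str, ih]; rfl

theorem enc_strPair {a b : ℕ} (w : List (Fin a) × List (Fin b)) : Dat.pair w = enc w := by
  rw [Dat.pair, enc_str, enc_str]; rfl

end DatEnc

open DatEnc

/-! ### Functions computable with bounded cost -/

/-- Classes of monotone cost functions with the closure properties of the polynomials. -/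
class CostClass (C : (ℕ → ℕ) → Prop) : Prop where
  mono : ∀ {b}, C b → Monotone b
  id : C (fun n => n)
  const : ∀ c, C (fun _ => c)
  add : ∀ {a b}, C a → C b → C (fun n => a n + b n)
  mul : ∀ {a b}, C a → C b → C (fun n => a n * b n)
  comp : ∀ {a b}, C a → C b → C (fun n => a (b n))

/-- `f` is computed by a program; the running time and the size of the output are bounded by a
function from `C` of the size of the input. -/
def Cmp (C : (ℕ → ℕ) → Prop) {α β : Type} [DatEnc α] [DatEnc β] (f : α → β) : Prop :=
  ∃ (P : Prog) (b : ℕ → ℕ), C b ∧ ∀ a, (∃ n ≤ b (sz a), P.Runs (enc a) (enc (f a)) n) ∧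
    sz (f a) ≤ b (sz a)

namespace Cmp

set_option linter.unusedSectionVars false

open CostClass (add mul mono)

variable {C : (ℕ → ℕ) → Prop} [CostClass C]
variable {α β γ δ σ : Type} [DatEnc α] [DatEnc β] [DatEnc γ] [DatEnc δ] [DatEnc σ]

theorem of_enc {f : α → β} {g : α → γ} (hg : Cmp C g) (h : ∀ a, enc (f a) = enc (g a)) :
    Cmp C f := by
  obtain ⟨P, b, hb, H⟩ := hg
  refine ⟨P, b, hb, fun a => ?_⟩
  have h1 : sz (f a) = sz (g a) := congrArg Dat.size (h a)
  rw [h, h1]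
  exact H a

theorem of_enc_self {f : α → β} (h : ∀ a, enc (f a) = enc a) : Cmp C f :=
  ⟨.id, fun n => n + 1, add CostClass.id (CostClass.const 1), fun a =>
    ⟨⟨1, Nat.le_add_left .., by rw [h]; exact .id _⟩,
      (congrArg Dat.size (h a)).le.trans (Nat.le_succ _)⟩⟩

theorem id : Cmp C (fun a : α => a) := of_enc_self fun _ => rfl

theorem comp {f : α → β} {g : β → γ} (hg : Cmp C g) (hf : Cmp C f) :
    Cmp C (fun a => g (f a)) := by
  obtain ⟨P, b, hb, H⟩ := hf
  obtain ⟨Q, c, hc, G⟩ := hg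
  refine ⟨.seq P Q, fun n => b n + c (b n) + 1,
    add (add hb (CostClass.comp hc hb)) (CostClass.const 1), fun a => ?_⟩
  obtain ⟨⟨n, hn, hP⟩, hs⟩ := H a
  obtain ⟨⟨m, hm, hQ⟩, ht⟩ := G (f a)
  have := mono hc hs
  dsimp only at *
  exact ⟨⟨n + m + 1, by omega, .seq hP hQ⟩, by omega⟩

theorem pair {f : α → β} {g : α → γ} (hf : Cmp C f) (hg : Cmp C g) :
    Cmp C (fun a => (f a, g a)) := by
  obtain ⟨P, b, hb, H⟩ := hf
  obtain ⟨Q, c, hc, G⟩ := hg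
  refine ⟨.cons P Q, fun n => b n + c n + 1, add (add hb hc) (CostClass.const 1), fun a => ?_⟩
  obtain ⟨⟨n, hn, hP⟩, hs⟩ := H a
  obtain ⟨⟨m, hm, hQ⟩, ht⟩ := G a
  dsimp only at *
  exact ⟨⟨n + m + 1, by omega, .cons hP hQ⟩, by simp; omega⟩

theorem hd : Cmp C Dat.hd :=
  ⟨.hd, fun n => n + 1, add CostClass.id (CostClass.const 1), fun a =>
    ⟨⟨1, Nat.le_add_left .., .hd _⟩, le_trans (Dat.size_hd_le a) (Nat.le_succ _)⟩⟩

theorem tl : Cmp C Dat.tl :=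
  ⟨.tl, fun n => n + 1, add CostClass.id (CostClass.const 1), fun a =>
    ⟨⟨1, Nat.le_add_left .., .tl _⟩, le_trans (Dat.size_tl_le a) (Nat.le_succ _)⟩⟩

theorem fst' : Cmp C (fun p : α × β => p.1) :=
  of_enc (hd.comp (of_enc_self (f := fun p : α × β => enc p) fun _ => rfl)) fun _ => rfl

theorem snd' : Cmp C (fun p : α × β => p.2) :=
  of_enc (tl.comp (of_enc_self (f := fun p : α × β => enc p) fun _ => rfl)) fun _ => rfl

theorem fst {f : α → β × γ} (hf : Cmp C f) : Cmp C (fun a => (f a).1) := fst'.comp hf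

theorem snd {f : α → β × γ} (hf : Cmp C f) : Cmp C (fun a => (f a).2) := snd'.comp hf

theorem const (b : β) : Cmp C (fun _ : α => b) := by
  suffices ∀ x : Dat, Cmp C (fun _ : α => x) from of_enc (this (enc b)) fun _ => rfl
  intro x
  induction x with
  | nil => exact ⟨.nil, fun _ => 1, CostClass.const 1, fun a =>
      ⟨⟨1, le_rfl, .nil _⟩, by simp [sz, Dat.size]⟩⟩
  | cons u v hu hv => exact of_enc (hu.pair hv) fun _ => rfl

theorem nil : Cmp C (fun _ : α => ([] : List β)) := const _

theorem cons {f : α → β} {g : α → List β} (hf : Cmp C f) (hg : Cmp C g) :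
    Cmp C (fun a => f a :: g a) := of_enc (hf.pair hg) fun _ => rfl

theorem singleton {f : α → β} (hf : Cmp C f) : Cmp C (fun a => [f a]) := hf.cons nil

theorem listRec {f : α → List β} {g : α → γ} {h : α → β → List β → γ} (hf : Cmp C f)
    (hg : Cmp C g) (hh : Cmp C (fun q : α × β × List β => h q.1 q.2.1 q.2.2)) :
    Cmp C (fun a => List.casesOn (motive := fun _ => γ) (f a) (g a) (h a)) := by
  obtain ⟨P, b, hb, H⟩ := hf
  obtain ⟨Q, c, hc, G⟩ := hg
  obtain ⟨R, e, he, K⟩ := hh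
  refine ⟨.cond P (.seq (.cons .id P) R) Q,
    fun n => b n + c n + (b n + 4) + e (n + b n + 1), ?_, fun a => ?_⟩
  · exact add (add (add hb hc) (add hb (CostClass.const 4)))
      (CostClass.comp he (add (add CostClass.id hb) (CostClass.const 1)))
  · obtain ⟨⟨n, hn, hP⟩, hs⟩ := H a
    obtain ⟨⟨m, hm, hQ⟩, ht⟩ := G a
    dsimp only at *
    cases hfa : f a with
    | nil =>
      rw [hfa] at hP
      exact ⟨⟨n + m + 1, by omega, .condFalse hP hQ⟩, by simp; omega⟩
    | cons x l =>
      rw [hfa] at hP hs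
      obtain ⟨⟨r, hr, hR⟩, hu⟩ := K (a, x, l)
      have h1 : sz (a, x, l) ≤ sz a + b (sz a) + 1 := by simp at hs ⊢; omega
      have h2 := mono he h1
      dsimp only at *
      refine ⟨⟨n + ((1 + n + 1) + r + 1) + 1, by omega, ?_⟩, hu.trans (by omega)⟩
      exact .condTrue hP (.seq (.cons (.id _) hP) hR)

theorem ite {p : α → Prop} [DecidablePred p] {f g : α → β} (hp : Cmp C (fun a => decide (p a)))
    (hf : Cmp C f) (hg : Cmp C g) : Cmp C (fun a => if p a then f a else g a) := by
  have h1 : Cmp C (fun a => if p a then [Dat.nil] else []) := by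
    refine of_enc hp fun a => ?_
    by_cases h : p a <;> simp [h]
  have h2 := listRec (h := fun a _ _ => f a) h1 hg (hf.comp fst')
  convert h2 using 2 with a
  by_cases h : p a <;> simp [h]

theorem loop_runs {st : γ → γ} {test : γ → Bool} {P Q : Prog} {b c : ℕ → ℕ} (hb : Monotone b)
    (hc : Monotone c) (H : ∀ a, ∃ n ≤ b (sz a), P.Runs (enc a) (enc (test a)) n)
    (G : ∀ a, ∃ n ≤ c (sz a), Q.Runs (enc a) (enc (st a)) n) (B : ℕ) (m : ℕ) :
    ∀ g, (∀ j < m, test (st^[j] g) = true) → test (st^[m] g) = false →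
      (∀ j ≤ m, sz (st^[j] g) ≤ B) →
      ∃ n ≤ (m + 1) * (b B + c B + 1), (Prog.loop P Q).Runs (enc g) (enc (st^[m] g)) n := by
  induction m with
  | zero =>
    intro g _ h2 h3
    obtain ⟨n, hn, hP⟩ := H g
    simp only [Function.iterate_zero, id_eq] at h2
    rw [h2] at hP
    have := hb (h3 0 le_rfl)
    simp only [Function.iterate_zero, id_eq] at this
    exact ⟨n + 1, by omega, .loopDone hP⟩
  | succ m ih =>
    intro g h1 h2 h3
    obtain ⟨n, hn, hP⟩ := H g
    obtain ⟨r, hr, hQ⟩ := G g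
    have h0 := h1 0 (Nat.succ_pos _)
    have hB := h3 0 (Nat.zero_le _)
    simp only [Function.iterate_zero, id_eq] at h0 hB
    rw [h0] at hP
    obtain ⟨s, hs, hL⟩ := ih (st g) (fun j hj => h1 (j + 1) (by omega)) h2
      (fun j hj => h3 (j + 1) (by omega))
    have := hb hB
    have := hc hB
    refine ⟨n + r + s + 1, ?_, .loopStep hP hQ hL⟩
    rw [add_mul (m + 1)]
    omega

/-- While loops of bounded length over states of bounded size. -/
theorem iterate {i : σ → γ} {st : γ → γ} {test : γ → Bool} {N : σ → ℕ} (hi : Cmp C i)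
    (hst : Cmp C st) (htest : Cmp C test) (h1 : ∀ s, ∀ j < N s, test (st^[j] (i s)) = true)
    (h2 : ∀ s, test (st^[N s] (i s)) = false) {b : ℕ → ℕ} (hb : C b)
    (hN : ∀ s, N s ≤ b (sz s)) (hsz : ∀ s, ∀ j ≤ N s, sz (st^[j] (i s)) ≤ b (sz s)) :
    Cmp C (fun s => st^[N s] (i s)) := by
  obtain ⟨P, c, hc, H⟩ := hi
  obtain ⟨Q, e, he, G⟩ := hst
  obtain ⟨R, f, hf, K⟩ := htest
  refine ⟨.seq P (.loop R Q),
    fun n => c n + (b n + 1) * (f (b n) + e (b n) + 1) + 1 + b n, ?_, fun s => ?_⟩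
  · exact add (add (add hc (mul (add hb (CostClass.const 1)) (add (add (CostClass.comp hf hb)
      (CostClass.comp he hb)) (CostClass.const 1)))) (CostClass.const 1)) hb
  · obtain ⟨⟨n, hn, hP⟩, -⟩ := H s
    obtain ⟨m, hm, hL⟩ := loop_runs (mono hf) (mono he) (fun a => (K a).1) (fun a => (G a).1)
      (b (sz s)) (N s) (i s) (h1 s) (h2 s) (hsz s)
    dsimp only at *
    have h3 : (N s + 1) * (f (b (sz s)) + e (b (sz s)) + 1) ≤
        (b (sz s) + 1) * (f (b (sz s)) + e (b (sz s)) + 1) :=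
      Nat.mul_le_mul_right _ (Nat.succ_le_succ (hN s))
    exact ⟨⟨n + m + 1, by omega, .seq hP hL⟩, (hsz s _ le_rfl).trans (Nat.le_add_left ..)⟩

theorem foldl {l : σ → List β} {i : σ → γ} {st : σ → γ → β → γ} (hl : Cmp C l) (hi : Cmp C i)
    (hst : Cmp C (fun q : σ × γ × β => st q.1 q.2.1 q.2.2)) {b : ℕ → ℕ} (hb : C b)
    (hsz : ∀ s l', l' <+: l s → sz (l'.foldl (st s) (i s)) ≤ b (sz s)) :
    Cmp C (fun s => (l s).foldl (st s) (i s)) := by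
  let step : σ × List β × γ → σ × List β × γ := fun q =>
    List.casesOn (motive := fun _ => σ × List β × γ) q.2.1 q (fun x l => (q.1, l, st q.1 q.2.2 x))
  have hstep : Cmp C step := by
    refine listRec (f := fun q : σ × List β × γ => q.2.1) (g := fun q => q)
      (h := fun q x l => (q.1, l, st q.1 q.2.2 x)) (fst snd') id ?_
    refine pair (fst fst') (pair (snd snd') ?_)
    exact hst.comp (g := fun q : σ × γ × β => st q.1 q.2.1 q.2.2)
      (f := fun q : (σ × List β × γ) × β × List β => (q.1.1, q.1.2.2, q.2.1))
      (pair (fst fst') (pair (snd (snd fst')) (fst snd')))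
  have hiter : ∀ s, ∀ j (l : List β) (a : γ), j ≤ l.length →
      step^[j] (s, l, a) = (s, l.drop j, (l.take j).foldl (st s) a) := by
    intro s j
    induction j with
    | zero => intro l a _; simp
    | succ j ih => intro l a hj; cases l with
      | nil => simp at hj
      | cons x l => simpa [step] using ih l (st s a x) (by simpa using hj)
  have htest : Cmp C (fun q : σ × List β × γ =>
      List.casesOn (motive := fun _ => Bool) q.2.1 false (fun _ _ => true)) :=
    listRec (f := fun q : σ × List β × γ => q.2.1) (h := fun _ _ _ => true) (fst snd')
      (const _) (const _)
  have hl' := hl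
  obtain ⟨P, c, hc, H⟩ := hl'
  have := iterate (N := fun s => (l s).length) (b := fun n => c n + (n + c n + b n + 2))
    (pair id (pair hl hi)) hstep htest ?_ ?_ ?_ ?_ ?_
  · have h2 := snd (snd this)
    convert h2 using 2 with s
    rw [hiter s _ _ _ le_rfl]
    simp
  · intro s j hj
    rw [hiter s _ _ _ hj.le]
    cases h : (l s).drop j with
    | nil => rw [List.drop_eq_nil_iff] at h; omega
    | cons => rfl
  · intro s
    rw [hiter s _ _ _ le_rfl]
    simp
  · exact add hc (add (add (add CostClass.id hc) hb) (CostClass.const 2))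
  · intro s
    have := length_le_sz (l s)
    have := (H s).2
    omega
  · intro s j hj
    rw [hiter s _ _ _ hj]
    have h1 := (H s).2
    have h2 := hsz s _ ((l s).take_prefix j)
    have h3 : sz ((l s).drop j) ≤ sz (l s) := by
      conv_rhs => rw [← List.take_append_drop j (l s), sz_append]
      omega
    simp only [sz_pair]
    omega

end Cmp

namespace Cmp

open CostClass (add mul mono)

set_option linter.unusedSectionVars false

variable {C : (ℕ → ℕ) → Prop} [CostClass C]
variable {α β γ δ σ : Type} [DatEnc α] [DatEnc β] [DatEnc γ] [DatEnc δ] [DatEnc σ]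

theorem exists_bound {f : α → β} (hf : Cmp C f) : ∃ b, C b ∧ ∀ a, sz (f a) ≤ b (sz a) := by
  obtain ⟨_, b, hb, H⟩ := hf
  exact ⟨b, hb, fun a => (H a).2⟩

/-- Folds whose accumulator grows in each step by a bounded amount. -/
theorem foldl_of_add {l : σ → List β} {i : σ → γ} {st : σ → γ → β → γ} (hl : Cmp C l)
    (hi : Cmp C i) (hst : Cmp C (fun q : σ × γ × β => st q.1 q.2.1 q.2.2)) {b : ℕ → ℕ} (hb : C b)
    (hsz : ∀ s a, ∀ x ∈ l s, sz (st s a x) ≤ sz a + b (sz s)) :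
    Cmp C (fun s => (l s).foldl (st s) (i s)) := by
  obtain ⟨c, hc, hc'⟩ := hl.exists_bound
  obtain ⟨e, he, he'⟩ := hi.exists_bound
  refine foldl hl hi hst (add he (mul hc hb)) fun s l' hl' => ?_
  have key : ∀ (l' : List β) (a : γ), (∀ x ∈ l', x ∈ l s) →
      sz (l'.foldl (st s) a) ≤ sz a + l'.length * b (sz s) := by
    intro l'
    induction l' with
    | nil => intro a _; simp
    | cons x l' ih =>
      intro a h
      have h1 := ih (st s a x) fun y hy => h y (by simp [hy])
      have h2 := hsz s a x (h x (by simp))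
      simp only [List.foldl_cons, List.length_cons, add_mul, one_mul]
      omega
  refine (key l' _ fun x hx => hl'.subset hx).trans (Nat.add_le_add (he' s) ?_)
  exact Nat.mul_le_mul_right _ ((hl'.length_le.trans (length_le_sz _)).trans (hc' s))

theorem reverse_append {f g : α → List β} (hf : Cmp C f) (hg : Cmp C g) :
    Cmp C (fun a => (f a).reverse ++ g a) := by
  obtain ⟨b, hb, hb'⟩ := hf.exists_bound
  have := foldl_of_add (st := fun _ acc x => x :: acc) hf hg
    (cons (snd snd') (fst snd')) (add hb (CostClass.const 1)) fun s a x hx => by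
      have := (sz_le_of_mem hx).trans (hb' s)
      simp; omega
  simpa using this

theorem reverse {f : α → List β} (hf : Cmp C f) : Cmp C (fun a => (f a).reverse) := by
  simpa using reverse_append hf nil

theorem append {f g : α → List β} (hf : Cmp C f) (hg : Cmp C g) :
    Cmp C (fun a => f a ++ g a) := by
  simpa using reverse_append (reverse hf) hg

theorem flatMap {f : α → List β} {g : α → β → List γ} (hf : Cmp C f)
    (hg : Cmp C (fun q : α × β => g q.1 q.2)) : Cmp C (fun a => (f a).flatMap (g a)) := by
  obtain ⟨b, hb, hb'⟩ := hf.exists_bound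
  obtain ⟨c, hc, hc'⟩ := hg.exists_bound
  have := foldl_of_add (st := fun s acc x => acc ++ g s x) hf (nil (β := γ))
    (append (fst snd') (hg.comp (f := fun q : α × List γ × β => (q.1, q.2.2))
      (pair fst' (snd snd')))) (b := fun n => c (n + b n + 1))
    (CostClass.comp hc (add (add CostClass.id hb) (CostClass.const 1))) fun s a x hx => by
      have h1 := (sz_le_of_mem hx).trans (hb' s)
      have h2 := hc' (s, x)
      have h3 : c (sz (s, x)) ≤ c (sz s + b (sz s) + 1) := mono hc (by simp; omega)
      simp only [sz_append]
      dsimp only at h2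
      omega
  convert this using 2 with a
  have key : ∀ (l : List β) (acc : List γ),
      l.foldl (fun acc x => acc ++ g a x) acc = acc ++ l.flatMap (g a) := by
    intro l
    induction l with
    | nil => simp
    | cons x l ih => intro acc; simp [ih, List.append_assoc]
  rw [key]; simp

theorem map {f : α → List β} {g : α → β → γ} (hf : Cmp C f)
    (hg : Cmp C (fun q : α × β => g q.1 q.2)) : Cmp C (fun a => (f a).map (g a)) := by
  convert flatMap (g := fun a x => [g a x]) hf (singleton hg) using 2 with a
  rw [List.map_eq_flatMap]

theorem tail {f : α → List β} (hf : Cmp C f) : Cmp C (fun a => (f a).tail) := by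
  convert listRec (g := fun _ => []) (h := fun _ _ l => l) hf nil (snd snd') using 2 with a
  cases f a <;> rfl

end Cmp

/-- Predicates that are decidable with bounded cost. -/
def CmpPred (C : (ℕ → ℕ) → Prop) {α : Type} [DatEnc α] (p : α → Prop) : Prop :=
  Cmp C (fun a => @decide (p a) (Classical.dec _))

namespace CmpPred

set_option linter.unusedSectionVars false

variable {C : (ℕ → ℕ) → Prop} [CostClass C]
variable {α β γ δ σ : Type} [DatEnc α] [DatEnc β] [DatEnc γ] [DatEnc δ] [DatEnc σ]

theorem of_cmp {f : α → Bool} {p : α → Prop} (hf : Cmp C f) (h : ∀ a, f a = true ↔ p a) :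
    CmpPred C p := by
  unfold CmpPred
  convert hf using 2 with a
  rw [Bool.eq_iff_iff, h]; simp

theorem congr {p q : α → Prop} (hp : CmpPred C p) (h : ∀ a, p a ↔ q a) : CmpPred C q := by
  have : p = q := funext fun a => propext (h a)
  rwa [← this]

theorem comp {p : β → Prop} {f : α → β} (hp : CmpPred C p) (hf : Cmp C f) :
    CmpPred C (fun a => p (f a)) := Cmp.comp hp hf

theorem _root_.Cmp.ite' {p : α → Prop} [DecidablePred p] {f g : α → β} (hp : CmpPred C p)
    (hf : Cmp C f) (hg : Cmp C g) : Cmp C (fun a => if p a then f a else g a) :=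
  Cmp.ite (by unfold CmpPred at hp; convert hp) hf hg

open Classical in
theorem and {p q : α → Prop} (hp : CmpPred C p) (hq : CmpPred C q) :
    CmpPred C (fun a => p a ∧ q a) :=
  of_cmp (Cmp.ite' hp hq (Cmp.const false)) fun a => by simp

open Classical in
theorem or {p q : α → Prop} (hp : CmpPred C p) (hq : CmpPred C q) :
    CmpPred C (fun a => p a ∨ q a) :=
  of_cmp (Cmp.ite' hp (Cmp.const true) hq) fun a => by simp

open Classical in
theorem not {p : α → Prop} (hp : CmpPred C p) : CmpPred C (fun a => ¬ p a) :=
  of_cmp (Cmp.ite' hp (Cmp.const false) (Cmp.const true)) fun a => by simp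

theorem eq_nil {f : α → List β} (hf : Cmp C f) : CmpPred C (fun a => f a = []) :=
  of_cmp (Cmp.listRec (g := fun _ => true) (h := fun _ _ _ => false) hf (Cmp.const _)
    (Cmp.const _)) fun a => by cases f a <;> simp

end CmpPred

namespace Cmp

set_option linter.unusedSectionVars false

variable {C : (ℕ → ℕ) → Prop} [CostClass C]
variable {α β γ δ σ : Type} [DatEnc α] [DatEnc β] [DatEnc γ] [DatEnc δ] [DatEnc σ]

theorem filter {f : α → List β} {p : α → β → Prop} [∀ a, DecidablePred (p a)] (hf : Cmp C f)
    (hp : CmpPred C (fun q : α × β => p q.1 q.2)) :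
    Cmp C (fun a => (f a).filter (fun x => p a x)) := by
  have := flatMap (g := fun a x => if p a x then [x] else []) hf (ite' hp (singleton snd') nil)
  convert this using 2 with a
  induction f a with
  | nil => rfl
  | cons x l ih => by_cases h : p a x <;> simp [h, ih]

end Cmp

namespace CmpPred

set_option linter.unusedSectionVars false

variable {C : (ℕ → ℕ) → Prop} [CostClass C]
variable {α β γ δ σ : Type} [DatEnc α] [DatEnc β] [DatEnc γ] [DatEnc δ] [DatEnc σ]

open Classical in
theorem exists_mem {f : α → List β} {p : α → β → Prop} (hf : Cmp C f)
    (hp : CmpPred C (fun q : α × β => p q.1 q.2)) : CmpPred C (fun a => ∃ x ∈ f a, p a x) :=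
  congr (not (eq_nil (Cmp.filter hf hp))) fun a => by simp

open Classical in
theorem forall_mem {f : α → List β} {p : α → β → Prop} (hf : Cmp C f)
    (hp : CmpPred C (fun q : α × β => p q.1 q.2)) : CmpPred C (fun a => ∀ x ∈ f a, p a x) :=
  congr (not (exists_mem (p := fun a x => ¬ p a x) hf (not hp))) fun a => by simp

theorem eq_true {f : α → Bool} (hf : Cmp C f) : CmpPred C (fun a => f a = true) :=
  of_cmp hf fun _ => Iff.rfl

end CmpPred

/-! ### Equality of trees -/

namespace Dat

/-- The immediate subtrees along the right spine: a bijection between trees and lists of trees. -/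
def toList : Dat → List Dat
  | nil => []
  | cons u v => u :: v.toList

@[simp] theorem enc_toList (x : Dat) : enc x.toList = x := by
  induction x with
  | nil => rfl
  | cons u v _ ih => simp [toList, ih]

@[simp] theorem toList_enc (l : List Dat) : (enc l).toList = l :=
  DatEnc.inj (by rw [enc_toList])

/-- A prefix code for trees. -/
def code : Dat → List Bool
  | nil => [false]
  | cons u v => true :: (u.code ++ v.code)

theorem code_append_inj : ∀ {x y : Dat} {r s : List Bool}, x.code ++ r = y.code ++ s → x = y ∧ r = s
  | nil, nil, r, s, h => by simpa [code] using h
  | nil, cons _ _, r, s, h => by simp [code] at h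
  | cons _ _, nil, r, s, h => by simp [code] at h
  | cons u v, cons u' v', r, s, h => by
    simp only [code, List.cons_append, List.append_assoc, List.cons.injEq, true_and] at h
    obtain ⟨rfl, h1⟩ := code_append_inj h
    obtain ⟨rfl, h2⟩ := code_append_inj h1
    exact ⟨rfl, h2⟩

theorem code_injective : Function.Injective code := fun x y h =>
  (code_append_inj (r := []) (s := []) (by simpa using h)).1

/-- One step of a traversal in preorder. -/
def codeStep (q : List Dat × List Bool) : List Dat × List Bool :=
  List.casesOn (motive := fun _ => List Dat × List Bool) q.1 q fun x st =>
    List.casesOn (motive := fun _ => List Dat × List Bool) x.toList (st, false :: q.2)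
      fun u v => (u :: enc v :: st, true :: q.2)

def codeWeight (l : List Dat) : ℕ := (l.map fun x => 2 * x.size + 1).sum

theorem codeStep_cons_nil (st : List Dat) (out : List Bool) :
    codeStep (nil :: st, out) = (st, false :: out) := rfl

theorem codeStep_cons_cons (u v : Dat) (st : List Dat) (out : List Bool) :
    codeStep (cons u v :: st, out) = (u :: v :: st, true :: out) := by
  simp [codeStep, toList]

theorem codeStep_spec (q : List Dat × List Bool) (h : q.1 ≠ []) :
    codeWeight (codeStep q).1 + 1 = codeWeight q.1 ∧
    (codeStep q).2.reverse ++ (codeStep q).1.flatMap code = q.2.reverse ++ q.1.flatMap code ∧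
    sz (codeStep q) ≤ sz q + 2 := by
  obtain ⟨_ | ⟨x, st⟩, out⟩ := q
  · simp at h
  · cases x with
    | nil => simp [codeStep_cons_nil, codeWeight, code, size]; omega
    | cons u v =>
      simp [codeStep_cons_cons, codeWeight, code, size, sz]; omega

theorem codeStep_iterate (j : ℕ) (q : List Dat × List Bool) (h : j ≤ codeWeight q.1) :
    codeWeight (codeStep^[j] q).1 + j = codeWeight q.1 ∧
    (codeStep^[j] q).2.reverse ++ (codeStep^[j] q).1.flatMap code =
      q.2.reverse ++ q.1.flatMap code ∧ sz (codeStep^[j] q) ≤ sz q + 2 * j := by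
  induction j with
  | zero => simp
  | succ j ih =>
    obtain ⟨h1, h2, h3⟩ := ih (by omega)
    have hne : (codeStep^[j] q).1 ≠ [] := by
      intro h0
      rw [h0] at h1
      simp [codeWeight] at h1
      simp [codeWeight] at h
      omega
    obtain ⟨k1, k2, k3⟩ := codeStep_spec _ hne
    rw [Function.iterate_succ_apply']
    exact ⟨by omega, k2.trans h2, by omega⟩

end Dat

namespace Cmp

set_option linter.unusedSectionVars false

variable {C : (ℕ → ℕ) → Prop} [CostClass C]
variable {α β γ δ σ : Type} [DatEnc α] [DatEnc β] [DatEnc γ] [DatEnc δ] [DatEnc σ]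

theorem toList {f : α → Dat} (hf : Cmp C f) : Cmp C (fun a => (f a).toList) :=
  of_enc hf fun a => by simp

theorem enc {f : α → β} (hf : Cmp C f) : Cmp C (fun a => enc (f a)) :=
  of_enc hf fun _ => rfl

theorem codeStep : Cmp C Dat.codeStep := by
  refine listRec (f := fun q : List Dat × List Bool => q.1) (g := fun q => q)
    (h := fun q x st => List.casesOn (motive := fun _ => List Dat × List Bool) x.toList
      (st, false :: q.2) fun u v => (u :: DatEnc.enc v :: st, true :: q.2)) fst' id ?_
  refine listRec (α := (List Dat × List Bool) × Dat × List Dat)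
    (f := fun q => q.2.1.toList) (g := fun q => (q.2.2, false :: q.1.2))
    (h := fun q u v => (u :: DatEnc.enc v :: q.2.2, true :: q.1.2)) (toList (fst snd'))
    (pair (snd snd') (cons (const _) (snd fst'))) ?_
  exact pair (cons (fst snd') (cons (enc (snd snd')) (snd (snd fst'))))
    (cons (const _) (snd (fst fst')))

theorem code {f : α → Dat} (hf : Cmp C f) : Cmp C (fun a => (f a).code) := by
  suffices Cmp C Dat.code from this.comp hf
  have htest : Cmp C (fun q : List Dat × List Bool =>
      List.casesOn (motive := fun _ => Bool) q.1 false (fun _ _ => true)) :=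
    listRec (f := fun q : List Dat × List Bool => q.1) (h := fun _ _ _ => true) fst'
      (const _) (const _)
  have hw : ∀ x : Dat, Dat.codeWeight [x] = 2 * sz x + 1 := fun x => by simp [Dat.codeWeight, sz]
  have := iterate (i := fun x : Dat => ([x], ([] : List Bool))) (N := fun x => 2 * sz x + 1)
    (b := fun n => n + 2 + 2 * (2 * n + 1)) (pair (singleton id) nil) codeStep htest ?_ ?_ ?_ ?_ ?_
  · have h2 := reverse (snd this)
    convert h2 using 2 with x
    obtain ⟨h3, h4, -⟩ := Dat.codeStep_iterate (2 * sz x + 1) ([x], []) (hw x).ge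
    generalize Dat.codeStep^[2 * sz x + 1] ([x], []) = q at *
    have h5 : q.1 = [] := by
      cases h : q.1 with
      | nil => rfl
      | cons => simp [h, Dat.codeWeight, sz] at h3
    simpa [h5] using h4.symm
  · intro x j hj
    obtain ⟨h3, -, -⟩ := Dat.codeStep_iterate j ([x], []) (hj.le.trans (hw x).ge)
    cases h : (Dat.codeStep^[j] ([x], [])).1 with
    | nil => rw [h] at h3; have := hw x; simp [Dat.codeWeight] at h3 this; omega
    | cons => rfl
  · intro x
    obtain ⟨h3, -, -⟩ := Dat.codeStep_iterate (2 * sz x + 1) ([x], []) (hw x).ge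
    generalize Dat.codeStep^[2 * sz x + 1] ([x], []) = q at *
    cases h : q.1 with
    | nil => rfl
    | cons => simp [h, Dat.codeWeight, sz] at h3
  · exact CostClass.add (CostClass.add CostClass.id (CostClass.const 2)) (CostClass.mul
      (CostClass.const 2) (CostClass.add (CostClass.mul (CostClass.const 2) CostClass.id)
      (CostClass.const 1)))
  · intro x; omega
  · intro x j hj
    obtain ⟨-, -, h3⟩ := Dat.codeStep_iterate j ([x], []) (hj.trans (hw x).ge)
    refine h3.trans ?_
    simp; omega

end Cmp

namespace CmpPred

set_option linter.unusedSectionVars false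

variable {C : (ℕ → ℕ) → Prop} [CostClass C]
variable {α β γ δ σ : Type} [DatEnc α] [DatEnc β] [DatEnc γ] [DatEnc δ] [DatEnc σ]

theorem eq_bool {f g : α → Bool} (hf : Cmp C f) (hg : Cmp C g) :
    CmpPred C (fun a => f a = g a) :=
  congr (or (and (eq_true hf) (eq_true hg)) (and (not (eq_true hf)) (not (eq_true hg)))) fun a => by
    cases f a <;> cases g a <;> simp

open Classical in
theorem eq_bools {f g : α → List Bool} (hf : Cmp C f) (hg : Cmp C g) :
    CmpPred C (fun a => f a = g a) := by
  let st : List Bool × Bool → Bool → List Bool × Bool := fun q b =>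
    List.casesOn (motive := fun _ => List Bool × Bool) q.1 ([], false)
      fun c m => (m, if b = c then q.2 else false)
  have hst : Cmp C (fun q : α × (List Bool × Bool) × Bool => st q.2.1 q.2.2) :=
    Cmp.listRec (f := fun q : α × (List Bool × Bool) × Bool => q.2.1.1) (g := fun _ => ([], false))
      (h := fun q c m => (m, if q.2.2 = c then q.2.1.2 else false)) (Cmp.fst (Cmp.fst Cmp.snd'))
      (Cmp.const _) (Cmp.pair (Cmp.snd Cmp.snd') (Cmp.ite'
        (eq_bool (Cmp.snd (Cmp.snd Cmp.fst')) (Cmp.fst Cmp.snd'))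
        (Cmp.snd (Cmp.fst (Cmp.snd Cmp.fst'))) (Cmp.const _)))
  have h1 := Cmp.foldl_of_add (st := fun _ => st) (b := fun _ => 1) hf
    (Cmp.pair hg (Cmp.const true)) hst (CostClass.const 1) fun s q b _ => by
      obtain ⟨_ | ⟨c, m⟩, ok⟩ := q
      · simp [st]
      · simp only [st, sz_pair, sz_cons]
        have := sz_bool_le (if b = c then ok else false)
        omega
  refine congr (and (eq_nil (Cmp.fst h1)) (eq_true (Cmp.snd h1))) fun a => ?_
  have key : ∀ (l m : List Bool) (ok : Bool), ((l.foldl st (m, ok)).1 = [] ∧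
      (l.foldl st (m, ok)).2 = true) ↔ l = m ∧ ok = true := by
    intro l
    induction l with
    | nil => intro m ok; simp [eq_comm]
    | cons b l ih =>
      intro m ok
      cases m with
      | nil => rw [List.foldl_cons, show st ([], ok) b = ([], false) from rfl, ih]; simp
      | cons c m =>
        rw [List.foldl_cons, show st (c :: m, ok) b = (m, if b = c then ok else false) from rfl, ih]
        by_cases h : b = c <;> simp [h]
  simp [key]

theorem eq {f g : α → β} (hf : Cmp C f) (hg : Cmp C g) : CmpPred C (fun a => f a = g a) :=
  congr (eq_bools (Cmp.code (Cmp.enc hf)) (Cmp.code (Cmp.enc hg))) fun a =>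
    ⟨fun h => DatEnc.inj (Dat.code_injective h), fun h => by rw [h]⟩

theorem mem {f : α → β} {g : α → List β} (hf : Cmp C f) (hg : Cmp C g) :
    CmpPred C (fun a => f a ∈ g a) :=
  congr (exists_mem (p := fun a x => x = f a) hg (eq Cmp.snd' (hf.comp Cmp.fst'))) fun a => by simp

end CmpPred

/-! ### Lists and unary numbers -/

namespace DatEnc

theorem enc_nat (n : ℕ) : enc n = enc (List.replicate n Dat.nil) := by
  induction n with
  | zero => rfl
  | succ n ih =>
    rw [List.replicate_succ, enc_cons, ← ih]; rfl

end DatEnc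

namespace Cmp

set_option linter.unusedSectionVars false

variable {C : (ℕ → ℕ) → Prop} [CostClass C]
variable {α β γ δ σ : Type} [DatEnc α] [DatEnc β] [DatEnc γ] [DatEnc δ] [DatEnc σ]

theorem unary {f : α → ℕ} (hf : Cmp C f) : Cmp C (fun a => List.replicate (f a) Dat.nil) :=
  of_enc hf fun a => (enc_nat (f a)).symm

theorem length {f : α → List β} (hf : Cmp C f) : Cmp C (fun a => (f a).length) :=
  of_enc (map (g := fun _ _ => Dat.nil) hf (const _)) fun a => by simp [enc_nat]

theorem add {f g : α → ℕ} (hf : Cmp C f) (hg : Cmp C g) : Cmp C (fun a => f a + g a) := by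
  simpa using length (append (unary hf) (unary hg))

theorem mul {f g : α → ℕ} (hf : Cmp C f) (hg : Cmp C g) : Cmp C (fun a => f a * g a) := by
  simpa using length (flatMap (g := fun a _ => List.replicate (g a) Dat.nil) (unary hf)
    (unary (hg.comp fst')))

theorem drop {f : α → ℕ} {g : α → List β} (hf : Cmp C f) (hg : Cmp C g) :
    Cmp C (fun a => (g a).drop (f a)) := by
  have := foldl_of_add (st := fun _ l _ => l.tail) (b := fun _ => 0) (unary hf) hg
    (tail (fst snd')) (CostClass.const 0) fun s a x _ => by cases a <;> simp; omega
  convert this using 2 with a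
  induction f a with
  | zero => rfl
  | succ n ih => rw [List.replicate_succ', List.foldl_append, ← ih]; simp [List.tail_drop]

theorem zip {f : α → List β} {g : α → List γ} (hf : Cmp C f) (hg : Cmp C g) :
    Cmp C (fun a => (f a).zip (g a)) := by
  obtain ⟨b, hb, hb'⟩ := hf.exists_bound
  let st : List γ × List (β × γ) → β → List γ × List (β × γ) := fun q x =>
    List.casesOn (motive := fun _ => List γ × List (β × γ)) q.1 q fun y m => (m, q.2 ++ [(x, y)])
  have hst : Cmp C (fun q : α × (List γ × List (β × γ)) × β => st q.2.1 q.2.2) :=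
    listRec (f := fun q : α × (List γ × List (β × γ)) × β => q.2.1.1) (g := fun q => q.2.1)
      (h := fun q y m => (m, q.2.1.2 ++ [(q.2.2, y)])) (fst (fst snd')) (fst snd')
      (pair (snd snd') (append (snd (fst (snd fst'))) (singleton (pair (snd (snd fst'))
        (fst snd')))))
  have := snd (foldl_of_add (st := fun _ => st) hf (pair hg nil) hst
    (CostClass.add hb (CostClass.const 1)) fun s q x hx => by
      have := (sz_le_of_mem hx).trans (hb' s)
      obtain ⟨_ | ⟨c, m⟩, o⟩ := q
      · simp [st]
      · simp [st, sz_append]; omega)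
  convert this using 2 with a
  have key : ∀ (l : List β) (m : List γ) o, (l.foldl st (m, o)).2 = o ++ l.zip m := by
    intro l
    induction l with
    | nil => simp
    | cons x l ih =>
      intro m o
      cases m with
      | nil => rw [List.foldl_cons, show st ([], o) x = ([], o) from rfl, ih]; simp
      | cons y m =>
        rw [List.foldl_cons, show st (y :: m, o) x = (m, o ++ [(x, y)]) from rfl, ih]; simp
  simp [key]

theorem take {f : α → ℕ} {g : α → List β} (hf : Cmp C f) (hg : Cmp C g) :
    Cmp C (fun a => (g a).take (f a)) := by
  convert map (g := fun _ (x : β × Dat) => x.1) (zip hg (unary hf)) (fst snd') using 2 with a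
  have key : ∀ (l : List β) (n : ℕ),
      l.take n = (l.zip (List.replicate n Dat.nil)).map fun x => x.1 := by
    intro l
    induction l with
    | nil => simp
    | cons x l ih => intro n; cases n <;> simp [List.replicate_succ, ih]
  exact key _ _

theorem range {f : α → ℕ} (hf : Cmp C f) : Cmp C (fun a => List.range (f a)) := by
  obtain ⟨b, hb, hb'⟩ := hf.exists_bound
  have key : ∀ l : List Dat, l.foldl (fun acc _ => acc ++ [acc.length]) [] =
      List.range l.length := by
    intro l
    induction l using List.reverseRecOn with
    | nil => rfl
    | append_singleton l x ih => simp [ih, List.range_succ]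
  have := foldl (st := fun _ (acc : List ℕ) _ => acc ++ [acc.length]) (b := fun n => b n * (b n + 1))
    (unary hf) nil
    (append (fst snd') (singleton (length (fst snd')))) (CostClass.mul hb (CostClass.add hb
      (CostClass.const 1))) fun s l hl => by
      rw [key]
      have h1 : l.length ≤ b (sz s) := by
        have := hl.length_le
        have := hb' s
        simp at *; omega
      refine (sz_le_of_forall (c := b (sz s)) fun a ha => ?_).trans ?_
      · simp at ha ⊢; omega
      · rw [List.length_range]; exact Nat.mul_le_mul_right _ h1
  simpa [key] using this

theorem flatten {f : α → List (List β)} (hf : Cmp C f) : Cmp C (fun a => (f a).flatten) := by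
  convert flatMap (g := fun _ l => l) hf snd' using 2 with a
  simp

end Cmp

namespace CmpPred

set_option linter.unusedSectionVars false

variable {C : (ℕ → ℕ) → Prop} [CostClass C]
variable {α β γ δ σ : Type} [DatEnc α] [DatEnc β] [DatEnc γ] [DatEnc δ] [DatEnc σ]

theorem le {f g : α → ℕ} (hf : Cmp C f) (hg : Cmp C g) : CmpPred C (fun a => f a ≤ g a) :=
  congr (eq_nil (Cmp.drop hg (Cmp.unary hf))) fun a => by simp; omega

theorem lt {f g : α → ℕ} (hf : Cmp C f) (hg : Cmp C g) : CmpPred C (fun a => f a < g a) :=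
  congr (not (le hg hf)) fun a => by simp

end CmpPred

/-! ### Polynomial and primitive recursive cost -/

/-- Polynomial cost. -/
def PolyCost (b : ℕ → ℕ) : Prop := ∃ p : Polynomial ℕ, b = fun n => p.eval n

/-- Primitive recursive cost. -/
def RecCost (b : ℕ → ℕ) : Prop := Monotone b ∧ Primrec b

theorem Polynomial.eval_nat_mono (p : Polynomial ℕ) : Monotone fun n => p.eval n := by
  induction p using Polynomial.induction_on' with
  | add p q hp hq => intro m n h; simpa using Nat.add_le_add (hp h) (hq h)
  | monomial i a => intro m n h; simpa using Nat.mul_le_mul_left _ (Nat.pow_le_pow_left h i)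

theorem Polynomial.eval_nat_le (p : Polynomial ℕ) : ∃ c, ∀ n, p.eval n ≤ c * (n + 1) ^ c := by
  induction p using Polynomial.induction_on' with
  | add p q hp hq =>
    obtain ⟨c, hc⟩ := hp
    obtain ⟨d, hd⟩ := hq
    refine ⟨c + d, fun n => ?_⟩
    have h1 : c * (n + 1) ^ c ≤ c * (n + 1) ^ (c + d) :=
      Nat.mul_le_mul_left _ (Nat.pow_le_pow_right (by omega) (by omega))
    have h2 : d * (n + 1) ^ d ≤ d * (n + 1) ^ (c + d) :=
      Nat.mul_le_mul_left _ (Nat.pow_le_pow_right (by omega) (by omega))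
    have := hc n
    have := hd n
    rw [Polynomial.eval_add, add_mul]
    omega
  | monomial i a =>
    refine ⟨a + i, fun n => ?_⟩
    rw [Polynomial.eval_monomial]
    exact Nat.mul_le_mul (by omega) ((Nat.pow_le_pow_left (by omega) i).trans
      (Nat.pow_le_pow_right (by omega) (by omega)))

instance : CostClass PolyCost where
  mono := by rintro _ ⟨p, rfl⟩; exact p.eval_nat_mono
  id := ⟨.X, by simp⟩
  const c := ⟨.C c, by simp⟩
  add := by rintro _ _ ⟨p, rfl⟩ ⟨q, rfl⟩; exact ⟨p + q, by simp⟩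
  mul := by rintro _ _ ⟨p, rfl⟩ ⟨q, rfl⟩; exact ⟨p * q, by simp⟩
  comp := by rintro _ _ ⟨p, rfl⟩ ⟨q, rfl⟩; exact ⟨p.comp q, by simp⟩

theorem Primrec.nat_pow' : Primrec₂ ((· ^ ·) : ℕ → ℕ → ℕ) := Primrec₂.unpaired'.1 Nat.Primrec.pow

instance : CostClass RecCost where
  mono h := h.1
  id := ⟨monotone_id, .id⟩
  const c := ⟨monotone_const, .const c⟩
  add h k := ⟨h.1.add k.1, Primrec.nat_add.comp h.2 k.2⟩
  mul h k := ⟨h.1.mul' k.1, Primrec.nat_mul.comp h.2 k.2⟩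
  comp h k := ⟨h.1.comp k.1, h.2.comp k.2⟩

namespace Cmp

variable {α β γ δ σ : Type} [DatEnc α] [DatEnc β] [DatEnc γ] [DatEnc δ] [DatEnc σ]

theorem foldl_rec {l : σ → List β} {i : σ → γ} {st : σ → γ → β → γ} (hl : Cmp RecCost l)
    (hi : Cmp RecCost i) (hst : Cmp RecCost (fun q : σ × γ × β => st q.1 q.2.1 q.2.2)) :
    Cmp RecCost (fun s => (l s).foldl (st s) (i s)) := by
  obtain ⟨c, hc, hc'⟩ := hl.exists_bound
  obtain ⟨d, hd, hd'⟩ := hi.exists_bound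
  obtain ⟨e, he, he'⟩ := hst.exists_bound
  let φ : ℕ → ℕ → ℕ := fun n m => m + e (n + (m + c n + 1) + 1)
  have hφ : ∀ {n n' m m' : ℕ}, n ≤ n' → m ≤ m' → φ n m ≤ φ n' m' := fun h h' =>
    Nat.add_le_add h' (he.1 (by have := hc.1 h; omega))
  have hit : ∀ {n n' m m' j j' : ℕ}, n ≤ n' → m ≤ m' → j ≤ j' →
      (φ n)^[j] m ≤ (φ n')^[j'] m' := by
    intro n n' m m' j j' h h' hj
    have h1 : (φ n)^[j] m ≤ (φ n')^[j] m' := by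
      clear hj
      induction j with
      | zero => exact h'
      | succ j ih => simp only [Function.iterate_succ_apply']; exact hφ h ih
    refine h1.trans ?_
    induction j', hj using Nat.le_induction with
    | base => exact le_rfl
    | succ j' _ ih =>
      rw [Function.iterate_succ_apply']
      exact ih.trans (Nat.le_add_right _ _)
  have hB : RecCost (fun n => (φ n)^[c n] (d n)) := by
    refine ⟨fun m n h => hit h (hd.1 h) (hc.1 h), Primrec.nat_iterate hc.2 hd.2 ?_⟩
    refine Primrec.nat_add.comp .snd (he.2.comp (Primrec.nat_add.comp (Primrec.nat_add.comp .fst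
      (Primrec.nat_add.comp (Primrec.nat_add.comp .snd (hc.2.comp .fst)) (.const 1))) (.const 1)))
  refine foldl hl hi hst hB fun s l' hl' => ?_
  have key : ∀ l' : List β, (∀ x ∈ l', x ∈ l s) →
      sz (l'.foldl (st s) (i s)) ≤ (φ (sz s))^[l'.length] (d (sz s)) := by
    intro l'
    induction l' using List.reverseRecOn with
    | nil => intro _; exact hd' s
    | append_singleton l' x ih =>
      intro h
      have h1 := ih fun y hy => h y (by simp [hy])
      have h2 := he' (s, l'.foldl (st s) (i s), x)
      have h3 := (sz_le_of_mem (h x (by simp))).trans (hc' s)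
      rw [List.foldl_append, List.length_append, List.length_singleton,
        Function.iterate_succ_apply']
      refine (h2.trans (he.1 ?_)).trans (Nat.le_add_left _ _)
      simp only [sz_pair]
      omega
  exact (key l' fun x hx => hl'.subset hx).trans
    (hit le_rfl le_rfl ((hl'.length_le.trans (length_le_sz _)).trans (hc' s)))

end Cmp

theorem DatEnc.sz_str_le {a : ℕ} (w : List (Fin a)) : sz w ≤ a * w.length := by
  induction w with
  | nil => simp
  | cons c w ih =>
    have := c.isLt
    simp only [sz_cons, sz_fin, List.length_cons, mul_add]
    omega

/-- A function is fpt-computable if it is computed in polynomial time from the input and data that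
depend computably on the parameter only. -/
theorem fptComputable_of_cmp {a b a' b' : ℕ} {κ : Type} [DatEnc κ] {G : List (Fin b) → κ}
    {F : List (Fin a) × κ → List (Fin a') × List (Fin b')} (hG : Cmp RecCost G)
    (hF : Cmp PolyCost F) : FptComputable fun w => F (w.1, G w.2) := by
  obtain ⟨P, r, hr, H⟩ := hG
  obtain ⟨Q, _, ⟨p, rfl⟩, K⟩ := hF
  obtain ⟨c, hc⟩ := p.eval_nat_le
  refine ⟨.seq (.cons .hd (.seq .tl P)) Q, fun n => r (b * n) + 5 + c * (r (b * n) + 2) ^ c,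
    (.C a * .X + 1) ^ c, ?_, fun x y => ?_⟩
  · have h1 : Primrec fun n => r (b * n) := hr.2.comp (Primrec.nat_mul.comp (.const b) .id)
    exact (Primrec.nat_add.comp (Primrec.nat_add.comp h1 (.const 5)) (Primrec.nat_mul.comp (.const c)
      (Primrec.nat_pow'.comp (Primrec.nat_add.comp h1 (.const 2)) (.const c)))).to_comp
  · obtain ⟨⟨n, hn, hP⟩, hs⟩ := H y
    obtain ⟨⟨m, hm, hQ⟩, -⟩ := K (x, G y)
    rw [enc_strPair, enc_strPair]
    refine ⟨(1 + (1 + n + 1) + 1) + m + 1, ?_, .seq (.cons (.hd _) (.seq (.tl _) hP)) hQ⟩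
    have hy := hr.1 (sz_str_le y)
    have hx := sz_str_le x
    have h1 := hm.trans (hc _)
    set R := r (b * y.length) with hR
    set A := a * x.length
    have h2 : sz (x, G y) + 1 ≤ (R + 2) * (A + 1) := by
      simp only [sz_pair]
      nlinarith
    have h3 : c * (sz (x, G y) + 1) ^ c ≤ c * ((R + 2) ^ c * (A + 1) ^ c) := by
      rw [← mul_pow]
      exact Nat.mul_le_mul_left _ (Nat.pow_le_pow_left h2 c)
    have h4 : (Polynomial.eval x.length ((.C a * .X + 1) ^ c : Polynomial ℕ)) = (A + 1) ^ c := by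
      simp [A]
    have h5 : 1 ≤ (A + 1) ^ c := Nat.one_le_pow _ _ (by omega)
    rw [h4, add_mul, mul_assoc]
    change _ ≤ (R + 5) * _ + c * ((R + 2) ^ c * _)
    have h6 : R + 5 ≤ (R + 5) * (A + 1) ^ c := Nat.le_mul_of_pos_right _ h5
    omega

/-! ### Unique readability -/

/-- The number with the given binary digits, least significant digit first. -/
def ofBits : List Bool → ℕ
  | [] => 0
  | b :: l => Nat.bit b (ofBits l)

theorem ofBits_bits (n : ℕ) : ofBits n.bits = n := by
  induction n using Nat.binaryRec' with
  | zero => simp [ofBits]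
  | bit b n h ih => rw [Nat.bits_append_bit _ _ h, ofBits, ih]

theorem bits_ofBits {l : List Bool} (h : l.reverse.take 1 ≠ [false]) : (ofBits l).bits = l := by
  induction l with
  | nil => simp [ofBits]
  | cons b l ih =>
    cases l with
    | nil => cases b <;> simp [ofBits] at h ⊢
    | cons c l =>
      have h' : (c :: l).reverse.take 1 ≠ [false] := by
        rw [List.reverse_cons, List.take_append_of_le_length (by simp)] at h
        exact h
      have := ih h'
      rw [ofBits, Nat.bits_append_bit, this]
      intro h0
      rw [h0] at this
      simp at this

namespace Fml

/-- The symbol of a binary digit in the encoding of formulas. -/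
def bitSym (b : Bool) : Fin 9 := if b then 8 else 7

theorem bitSym_append_inj : ∀ {l m : List Bool} {r s : List (Fin 9)},
    l.map bitSym ++ 6 :: r = m.map bitSym ++ 6 :: s → l = m ∧ r = s
  | [], [], r, s, h => by simpa using h
  | [], b :: m, r, s, h => by cases b <;> simp [bitSym] at h
  | b :: l, [], r, s, h => by cases b <;> simp [bitSym] at h
  | b :: l, c :: m, r, s, h => by
    simp only [List.map_cons, List.cons_append, List.cons.injEq] at h
    obtain ⟨rfl, rfl⟩ := bitSym_append_inj h.2
    have : b = c := by
      have := h.1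
      cases b <;> cases c <;> simp [bitSym] at this ⊢
    simp [this]

theorem encode_var (n : ℕ) : (var n).encode = 5 :: (n.bits.map bitSym ++ [6]) := by
  simp [encode, bitSym]

theorem encode_ne_end (a : Fml) (r s : List (Fin 9)) : a.encode ++ r ≠ 6 :: s := by
  cases a <;> simp [encode]

mutual

theorem encode_append_inj : ∀ (a b : Fml) (r s : List (Fin 9)),
    a.encode ++ r = b.encode ++ s → a = b ∧ r = s
  | var n, b, r, s, h => by
    cases b with
    | var m =>
      rw [encode_var, encode_var] at h
      simp only [List.cons_append, List.append_assoc, List.cons.injEq, true_and,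
        List.nil_append] at h
      obtain ⟨h1, rfl⟩ := bitSym_append_inj h
      rw [← ofBits_bits n, h1, ofBits_bits]
      simp
    | _ => simp [encode] at h
  | neg a, b, r, s, h => by
    cases b with
    | neg b =>
      simp only [encode, List.cons_append, List.cons.injEq, true_and] at h
      obtain ⟨rfl, rfl⟩ := encode_append_inj a b r s h
      simp
    | _ => simp [encode] at h
  | and a a', b, r, s, h => by
    cases b with
    | and b b' =>
      simp only [encode, List.cons_append, List.append_assoc, List.cons.injEq, true_and] at h
      obtain ⟨rfl, h2⟩ := encode_append_inj a b _ _ h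
      obtain ⟨rfl, rfl⟩ := encode_append_inj a' b' _ _ h2
      simp
    | _ => simp [encode] at h
  | or a a', b, r, s, h => by
    cases b with
    | or b b' =>
      simp only [encode, List.cons_append, List.append_assoc, List.cons.injEq, true_and] at h
      obtain ⟨rfl, h2⟩ := encode_append_inj a b _ _ h
      obtain ⟨rfl, rfl⟩ := encode_append_inj a' b' _ _ h2
      simp
    | _ => simp [encode] at h
  | bigAnd l, b, r, s, h => by
    cases b with
    | bigAnd m =>
      simp only [encode, List.cons_append, List.append_assoc, List.cons.injEq, true_and,
        List.nil_append] at h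
      obtain ⟨rfl, rfl⟩ := encode_list_append_inj l m r s h
      simp
    | _ => simp [encode] at h
  | bigOr l, b, r, s, h => by
    cases b with
    | bigOr m =>
      simp only [encode, List.cons_append, List.append_assoc, List.cons.injEq, true_and,
        List.nil_append] at h
      obtain ⟨rfl, rfl⟩ := encode_list_append_inj l m r s h
      simp
    | _ => simp [encode] at h

theorem encode_list_append_inj : ∀ (l m : List Fml) (r s : List (Fin 9)),
    (l.map encode).flatten ++ 6 :: r = (m.map encode).flatten ++ 6 :: s → l = m ∧ r = s
  | [], m, r, s, h => by
    cases m with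
    | nil => simpa using h
    | cons b m => simp [(encode_ne_end _ _ _).symm] at h
  | a :: l, m, r, s, h => by
    cases m with
    | nil => simp [encode_ne_end] at h
    | cons b m =>
      simp only [List.map_cons, List.flatten_cons, List.append_assoc] at h
      obtain ⟨rfl, h2⟩ := encode_append_inj a b _ _ h
      obtain ⟨rfl, rfl⟩ := encode_list_append_inj l m r s h2
      simp

end

theorem encode_injective : Function.Injective encode := fun a b h =>
  (encode_append_inj a b [] [] (by simpa using h)).1

theorem mem_foldr_vars {l : List Fml} {n : ℕ} :
    n ∈ (l.map vars).foldr (· ∪ ·) ∅ ↔ ∃ a ∈ l, n ∈ a.vars := by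
  induction l with
  | nil => simp
  | cons a l ih => simp [ih]

theorem foldr_max_le {l : List ℕ} {c : ℕ} : l.foldr max 0 ≤ c ↔ ∀ a ∈ l, a ≤ c := by
  induction l with
  | nil => simp
  | cons a l ih => simp [ih]

/-- A big conjunction (`c = true`) or disjunction (`c = false`). -/
def big (c : Bool) (l : List Fml) : Fml := if c then bigAnd l else bigOr l

/-- A small conjunction (`c = true`) or disjunction (`c = false`). -/
def small (c : Bool) (a b : Fml) : Fml := if c then and a b else or a b

/-- A positive or negative literal. -/
def lit (pol : Bool) (n : ℕ) : Fml := if pol then var n else neg (var n)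

theorem mem_vars_big {c : Bool} {l : List Fml} {n : ℕ} :
    n ∈ (big c l).vars ↔ ∃ a ∈ l, n ∈ a.vars := by
  cases c <;> simp [big, vars, mem_foldr_vars]

theorem vars_lit (pol : Bool) (n : ℕ) : (lit pol n).vars = {n} := by
  cases pol <;> simp [lit, vars]

theorem sat_lit (pol : Bool) (n : ℕ) (S : Finset ℕ) :
    (lit pol n).Sat S ↔ (n ∈ S ↔ pol = true) := by
  cases pol <;> simp [lit, Sat]

theorem sat_big_true {l : List Fml} {S : Finset ℕ} :
    (big true l).Sat S ↔ ∀ a ∈ l, a.Sat S := by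
  simp [big, Sat]

theorem sat_big_false {l : List Fml} {S : Finset ℕ} :
    (big false l).Sat S ↔ ∃ a ∈ l, a.Sat S := by
  simp [big, Sat]

theorem weft_big_le {c : Bool} {l : List Fml} {n : ℕ} (h : ∀ a ∈ l, a.weft ≤ n) :
    (big c l).weft ≤ n + 1 := by
  have : (l.map weft).foldr max 0 ≤ n := foldr_max_le.2 (by simpa using h)
  cases c <;> simpa [big, weft]

theorem depth_big_le {c : Bool} {l : List Fml} {n : ℕ} (h : ∀ a ∈ l, a.depth ≤ n) :
    (big c l).depth ≤ n + 1 := by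
  have : (l.map depth).foldr max 0 ≤ n := foldr_max_le.2 (by simpa using h)
  cases c <;> simpa [big, depth]

/-- The symbol of a big connective. -/
def bigSym (c : Bool) : Fin 9 := if c then 3 else 4

/-- The symbol of a small connective. -/
def smallSym (c : Bool) : Fin 9 := if c then 1 else 2

theorem encode_big (c : Bool) (l : List Fml) :
    (big c l).encode = bigSym c :: (l.flatMap encode ++ [6]) := by
  cases c <;> simp [big, encode, bigSym, List.flatMap]

theorem encode_foldl_small (c : Bool) (ls : List Fml) : ∀ l : Fml,
    (ls.foldl (small c) l).encode =
      ls.map (fun _ => smallSym c) ++ (l :: ls).flatMap encode := by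
  induction ls with
  | nil => simp
  | cons a ls ih =>
    intro l
    have h : (small c l a).encode = smallSym c :: (l.encode ++ a.encode) := by
      cases c <;> simp [small, encode, smallSym]
    have h2 : ∀ (n : ℕ) (k : List (Fin 9)), List.replicate n (smallSym c) ++ smallSym c :: k =
        smallSym c :: (List.replicate n (smallSym c) ++ k) := by
      intro n k
      induction n with
      | zero => rfl
      | succ n ih => simp [List.replicate_succ, ih]
    rw [List.foldl_cons, ih, List.flatMap_cons, h]
    simp [h2]

theorem sat_foldl_small (c : Bool) (S : Finset ℕ) (ls : List Fml) : ∀ l : Fml,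
    (ls.foldl (small c) l).Sat S ↔
      if c then ∀ a ∈ l :: ls, a.Sat S else ∃ a ∈ l :: ls, a.Sat S := by
  induction ls with
  | nil => simp
  | cons a ls ih =>
    intro l
    rw [List.foldl_cons, ih]
    cases c <;> simp [small, Sat, or_assoc, and_assoc]

theorem mem_vars_foldl_small (c : Bool) (n : ℕ) (ls : List Fml) : ∀ l : Fml,
    n ∈ (ls.foldl (small c) l).vars ↔ ∃ a ∈ l :: ls, n ∈ a.vars := by
  induction ls with
  | nil => simp
  | cons a ls ih =>
    intro l
    rw [List.foldl_cons, ih]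
    cases c <;> simp [small, vars, or_assoc]

end Fml

open Fml

/-! ### Normal forms as trees -/

/-- The tree that names the variable `X n`. -/
def nameOf (n : ℕ) : Dat := enc n.bits

/-- The index of the variable with the given name. -/
noncomputable def nameIdx (x : Dat) : ℕ := ofBits (x.toList.map fun b => decide (b ≠ .nil))

/-- Trees that are names of variables. -/
def IsName (x : Dat) : Prop :=
  (∀ b ∈ x.toList, b = .nil ∨ b = enc true) ∧ x.toList.reverse.take 1 ≠ [Dat.nil]

theorem toList_eq_map_enc (l : List Bool) : (enc l).toList = l.map enc := by
  induction l with
  | nil => rfl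
  | cons b l ih => rw [enc_cons, Dat.toList, ih]; rfl

theorem map_ne_nil_map_enc (l : List Bool) :
    (l.map enc).map (fun b => decide (b ≠ Dat.nil)) = l := by
  induction l with
  | nil => rfl
  | cons b l ih => cases b <;> simpa using ih

theorem nameIdx_nameOf (n : ℕ) : nameIdx (nameOf n) = n := by
  rw [nameIdx, nameOf, toList_eq_map_enc, map_ne_nil_map_enc, ofBits_bits]

theorem reverse_bits_take (n : ℕ) : n.bits.reverse.take 1 ≠ [false] := by
  induction n using Nat.binaryRec' with
  | zero => simp
  | bit b n h ih =>
    rw [Nat.bits_append_bit _ _ h, List.reverse_cons]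
    cases hn : n.bits with
    | nil =>
      have : n = 0 := by rw [← ofBits_bits n, hn]; rfl
      simp [h this]
    | cons c l =>
      rw [hn] at ih
      rwa [List.take_append_of_le_length (by simp)]

theorem isName_nameOf (n : ℕ) : IsName (nameOf n) := by
  rw [IsName, nameOf, toList_eq_map_enc]
  refine ⟨fun b hb => ?_, fun h => ?_⟩
  · obtain ⟨c, -, rfl⟩ := List.mem_map.1 hb
    cases c <;> simp
  · rw [← List.map_reverse, ← List.map_take] at h
    refine reverse_bits_take n ?_
    have : [Dat.nil] = [false].map enc := rfl
    rw [this] at h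
    exact (List.map_injective_iff.2 DatEnc.inj) h

theorem IsName.map_enc {x : Dat} (h : ∀ b ∈ x.toList, b = .nil ∨ b = enc true) :
    (x.toList.map fun b => decide (b ≠ Dat.nil)).map enc = x.toList := by
  rw [List.map_map]
  conv_rhs => rw [← List.map_id x.toList]
  refine List.map_congr_left fun b hb => ?_
  rcases h b hb with rfl | rfl <;> simp

theorem IsName.bits {x : Dat} (h : IsName x) :
    (nameIdx x).bits = x.toList.map fun b => decide (b ≠ Dat.nil) := by
  refine bits_ofBits fun h0 => h.2 ?_
  rw [← IsName.map_enc h.1, ← List.map_reverse, ← List.map_take, h0]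
  rfl

theorem IsName.nameOf_nameIdx {x : Dat} (h : IsName x) : nameOf (nameIdx x) = x := by
  refine Eq.trans ?_ (Dat.enc_toList x)
  rw [nameOf, h.bits]
  conv_rhs => rw [← IsName.map_enc h.1]
  rw [← toList_eq_map_enc, Dat.enc_toList]

/-- Whether the connective at level `s` of the normal form is a conjunction, if the connective next
to the literals, of the given sign, is a conjunction exactly for negative literals. -/
def isAnd (pol : Bool) : ℕ → Bool
  | 0 => !pol
  | s + 1 => !isAnd pol s

/-- The formula in normal form that is represented by a tree. -/
noncomputable def toFml (pol : Bool) : ℕ → Dat → Fml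
  | 0, v => List.casesOn (motive := fun _ => Fml) (v.toList.map fun x => lit pol (nameIdx x))
      (bigAnd []) fun l ls => ls.foldl (small (isAnd pol 0)) l
  | s + 1, v => big (isAnd pol (s + 1)) (v.toList.map (toFml pol s))

/-- The trees that represent formulas in normal form. -/
def Valid (d : ℕ) : ℕ → Dat → Prop
  | 0, v => v.toList ≠ [] ∧ v.toList.length ≤ d ∧ ∀ x ∈ v.toList, IsName x
  | s + 1, v => ∀ x ∈ v.toList, Valid d s x

/-- The names at the leaves. -/
def leaves : ℕ → Dat → List Dat
  | 0, v => v.toList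
  | s + 1, v => v.toList.flatMap (leaves s)

theorem Valid.isName {d : ℕ} : ∀ {s : ℕ} {v : Dat}, Valid d s v → ∀ x ∈ leaves s v, IsName x
  | 0, _, h, x, hx => h.2.2 x hx
  | s + 1, v, h, x, hx => by
    obtain ⟨w, hw, hx⟩ := List.mem_flatMap.1 hx
    exact (h w hw).isName x hx

theorem mem_vars_toFml {d pol} : ∀ {s : ℕ} {v : Dat}, Valid d s v → ∀ n,
    n ∈ (toFml pol s v).vars ↔ ∃ x ∈ leaves s v, nameIdx x = n
  | 0, v, h, n => by
    rw [toFml, leaves]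
    cases hv : v.toList with
    | nil => exact absurd hv h.1
    | cons x l =>
      simp only [List.map_cons]
      rw [mem_vars_foldl_small]
      simp [vars_lit, eq_comm]
  | s + 1, v, h, n => by
    rw [toFml, mem_vars_big, leaves]
    simp only [List.mem_map, List.mem_flatMap]
    constructor
    · rintro ⟨_, ⟨w, hw, rfl⟩, hn⟩
      obtain ⟨x, hx, rfl⟩ := (mem_vars_toFml (h w hw) n).1 hn
      exact ⟨x, ⟨w, hw, hx⟩, rfl⟩
    · rintro ⟨x, ⟨w, hw, hx⟩, rfl⟩
      exact ⟨_, ⟨w, hw, rfl⟩, (mem_vars_toFml (h w hw) _).2 ⟨x, hx, rfl⟩⟩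

theorem sat_toFml_one {d pol} {b : Dat} (h : Valid d 1 b) (S : Finset ℕ) :
    (toFml pol 1 b).Sat S ↔
      ((∀ e ∈ b.toList, ∃ x ∈ e.toList, nameIdx x ∈ S) ↔ pol = true) := by
  have h0 : ∀ e ∈ b.toList, ((toFml pol 0 e).Sat S ↔
      ((∃ x ∈ e.toList, nameIdx x ∈ S) ↔ pol = true)) := by
    intro e he
    have h1 := (h e he).1
    rw [toFml]
    cases hv : e.toList with
    | nil => exact absurd hv h1
    | cons x l =>
      simp only [List.map_cons]
      rw [sat_foldl_small]
      cases pol <;> simp [sat_lit, isAnd]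
  rw [toFml]
  cases pol
  · rw [show isAnd false 1 = false from rfl, sat_big_false]
    simp only [List.mem_map]
    simp only [Bool.false_eq_true, iff_false] at h0 ⊢
    push Not at h0 ⊢
    constructor
    · rintro ⟨_, ⟨e, he, rfl⟩, hs⟩
      exact ⟨e, he, (h0 e he).1 hs⟩
    · rintro ⟨e, he, hs⟩
      exact ⟨_, ⟨e, he, rfl⟩, (h0 e he).2 hs⟩
  · rw [show isAnd true 1 = true from rfl, sat_big_true]
    simp only [List.mem_map, iff_true] at h0 ⊢
    constructor
    · intro hs e he
      exact (h0 e he).1 (hs _ ⟨e, he, rfl⟩)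
    · rintro hs _ ⟨e, he, rfl⟩
      exact (h0 e he).2 (hs e he)

/-- The literals of the given sign. -/
def litSet (pol : Bool) : Set Fml := {α | ∃ n, α = lit pol n}

theorem exists_valid_zero {d pol} {op : Bool} (α : Fml) :
    (∃ (l : Fml) (ls : List Fml), (∀ β ∈ l :: ls, β ∈ litSet pol) ∧ (l :: ls).length ≤ d ∧
      α = ls.foldl (small op) l) ↔
    ∃ v, Valid d 0 v ∧ List.casesOn (motive := fun _ => Fml)
      (v.toList.map fun x => lit pol (nameIdx x)) (bigAnd [])
      (fun l ls => ls.foldl (small op) l) = α := by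
  constructor
  · rintro ⟨l, ls, h, hd, rfl⟩
    have : ∀ k : List Fml, (∀ β ∈ k, β ∈ litSet pol) → ∃ ns : List ℕ, k = ns.map (lit pol) := by
      intro k
      induction k with
      | nil => exact fun _ => ⟨[], rfl⟩
      | cons a k ih =>
        intro hk
        obtain ⟨ns, rfl⟩ := ih fun β hβ => hk β (by simp [hβ])
        obtain ⟨n, rfl⟩ := hk a (by simp)
        exact ⟨n :: ns, rfl⟩
    obtain ⟨ns, hns⟩ := this _ h
    refine ⟨enc (ns.map nameOf), ⟨?_, ?_, ?_⟩, ?_⟩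
    · rw [Dat.toList_enc]; rintro h0; simp at h0; simp [h0] at hns
    · rw [Dat.toList_enc, List.length_map, ← List.length_map (f := lit pol), ← hns]; exact hd
    · rw [Dat.toList_enc]
      intro x hx
      obtain ⟨n, -, rfl⟩ := List.mem_map.1 hx
      exact isName_nameOf n
    · rw [Dat.toList_enc, List.map_map]
      have : ((fun x => lit pol (nameIdx x)) ∘ nameOf) = lit pol := by
        funext n; simp [nameIdx_nameOf]
      rw [this, ← hns]
  · rintro ⟨v, ⟨h1, h2, -⟩, rfl⟩
    cases hv : v.toList with
    | nil => exact absurd hv h1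
    | cons x l =>
      refine ⟨lit pol (nameIdx x), l.map fun x => lit pol (nameIdx x), ?_, ?_, rfl⟩
      · intro β hβ
        simp only [List.mem_cons, List.mem_map] at hβ
        rcases hβ with rfl | ⟨y, -, rfl⟩ <;> exact ⟨_, rfl⟩
      · simpa [hv] using h2

theorem exists_valid_succ {d s pol} {K : Set Fml} (c : Bool)
    (hK : ∀ β, β ∈ K ↔ ∃ v, Valid d s v ∧ toFml pol s v = β) (α : Fml) :
    (∃ l : List Fml, (∀ β ∈ l, β ∈ K) ∧ α = big c l) ↔
      ∃ v, Valid d (s + 1) v ∧ big c (v.toList.map (toFml pol s)) = α := by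
  constructor
  · rintro ⟨l, h, rfl⟩
    have : ∃ vs : List Dat, (∀ v ∈ vs, Valid d s v) ∧ l = vs.map (toFml pol s) := by
      induction l with
      | nil => exact ⟨[], by simp, rfl⟩
      | cons a l ih =>
        obtain ⟨vs, h1, rfl⟩ := ih fun β hβ => h β (by simp [hβ])
        obtain ⟨v, hv, rfl⟩ := (hK a).1 (h a (by simp))
        exact ⟨v :: vs, by simpa using ⟨hv, h1⟩, rfl⟩
    obtain ⟨vs, h1, rfl⟩ := this
    exact ⟨enc vs, by simpa [Valid] using h1, by simp⟩
  · rintro ⟨v, hv, rfl⟩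
    refine ⟨_, fun β hβ => ?_, rfl⟩
    obtain ⟨w, hw, rfl⟩ := List.mem_map.1 hβ
    exact (hK _).2 ⟨w, hv w hw, rfl⟩

theorem mem_class_iff {d pol} : ∀ (s : ℕ) (α : Fml),
    α ∈ (if isAnd pol s then GammaClass (litSet pol) d s else DeltaClass (litSet pol) d s) ↔
      ∃ v, Valid d s v ∧ toFml pol s v = α
  | 0, α => by
    have := exists_valid_zero (d := d) (pol := pol) (op := isAnd pol 0) α
    have h1 : small true = Fml.and := rfl
    have h2 : small false = Fml.or := rfl
    cases h : isAnd pol 0 <;> rw [h] at this <;>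
      simpa [GammaClass, DeltaClass, toFml, h1, h2, h] using this
  | s + 1, α => by
    have := exists_valid_succ (isAnd pol (s + 1)) (mem_class_iff (d := d) (pol := pol) s) α
    cases h : isAnd pol s <;>
      simpa [GammaClass, DeltaClass, toFml, big, h, isAnd] using this

theorem nameIdx_injOn {s d : ℕ} {v : Dat} (h : Valid d s v) :
    Set.InjOn nameIdx {x | x ∈ leaves s v} := fun x hx y hy hxy => by
  rw [← (h.isName x hx).nameOf_nameIdx, hxy, (h.isName y hy).nameOf_nameIdx]

theorem vars_toFml {d s pol} {v : Dat} (h : Valid d s v) :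
    (toFml pol s v).vars = (leaves s v).toFinset.image nameIdx := by
  ext n
  rw [mem_vars_toFml h]
  simp

theorem kSat_toFml {d s pol} {v : Dat} (h : Valid d (s + 1) v) (hs : isAnd pol (s + 1) = false)
    (k : ℕ) : (toFml pol (s + 1) v).KSat k ↔ ∃ T ⊆ (leaves (s + 1) v).toFinset, T.card = k ∧
      ∃ a ∈ v.toList, (toFml pol s a).Sat (T.image nameIdx) := by
  have hsat : ∀ S, (toFml pol (s + 1) v).Sat S ↔ ∃ a ∈ v.toList, (toFml pol s a).Sat S := by
    intro S
    rw [toFml, hs, sat_big_false]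
    simp
  unfold KSat
  rw [vars_toFml h]
  simp only [Finset.subset_image_iff, hsat]
  have hcard : ∀ T ⊆ (leaves (s + 1) v).toFinset, (T.image nameIdx).card = T.card := by
    refine fun T hT => Finset.card_image_of_injOn fun x hx y hy => ?_
    exact nameIdx_injOn h (List.mem_toFinset.1 (hT hx)) (List.mem_toFinset.1 (hT hy))
  constructor
  · rintro ⟨_, ⟨T, hT, rfl⟩, hk, hS⟩
    exact ⟨T, hT, (hcard T hT).symm.trans hk, hS⟩
  · rintro ⟨T, hT, hk, hS⟩
    exact ⟨_, ⟨T, hT, rfl⟩, (hcard T hT).trans hk, hS⟩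

/-! ### Writing and reading normal forms -/

/-- The string of a literal. -/
noncomputable def litStr (pol : Bool) (x : Dat) : List (Fin 9) :=
  (if pol then [] else [0]) ++ 5 :: (x.toList.map (fun b => if b = .nil then 7 else 8) ++ [6])

theorem encode_lit {pol x} (h : IsName x) : (lit pol (nameIdx x)).encode = litStr pol x := by
  have : (nameIdx x).bits.map bitSym = x.toList.map (fun b => if b = .nil then 7 else 8) := by
    rw [h.bits, List.map_map]
    refine List.map_congr_left fun b _ => ?_
    by_cases hb : b = .nil <;> simp [bitSym, hb]
  cases pol <;> simp [lit, encode, litStr, ← this, bitSym]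

/-- The string of the formula that is represented by a tree. -/
noncomputable def encStr (pol : Bool) : ℕ → Dat → List (Fin 9)
  | 0, v => v.toList.tail.map (fun _ => smallSym (isAnd pol 0)) ++ v.toList.flatMap (litStr pol)
  | s + 1, v => bigSym (isAnd pol (s + 1)) :: (v.toList.flatMap (encStr pol s) ++ [6])

theorem flatMap_congr_mem {α β : Type} {l : List α} {f g : α → List β} (h : ∀ a ∈ l, f a = g a) :
    l.flatMap f = l.flatMap g := by
  rw [List.flatMap, List.flatMap, List.map_congr_left h]

theorem encode_toFml {d pol} : ∀ {s : ℕ} {v : Dat}, Valid d s v →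
    (toFml pol s v).encode = encStr pol s v
  | 0, v, h => by
    rw [toFml, encStr]
    have h2 := h.2.2
    cases hv : v.toList with
    | nil => exact absurd hv h.1
    | cons x l =>
      rw [hv] at h2
      simp only [List.map_cons]
      rw [encode_foldl_small, ← List.map_cons (f := fun x => lit pol (nameIdx x)), List.flatMap_map,
        flatMap_congr_mem fun y hy => encode_lit (h2 y hy), List.tail_cons, List.map_map]
      rfl
  | s + 1, v, h => by
    rw [toFml, encode_big, encStr, List.flatMap_map, flatMap_congr_mem fun w hw =>
      encode_toFml (h w hw)]

/-- The state of the parser: the stack of open lists, the current group of literals, the number of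
literals it still lacks in unary, the current name, and whether a name is being read. -/
abbrev ParseState := List (List Dat) × List Dat × List Dat × List Dat × Bool

/-- Append a tree to the top list of the stack. -/
def pushTop (x : Dat) (st : List (List Dat)) : List (List Dat) := (st.headD [] ++ [x]) :: st.tail

/-- One step of the parser, which does not detect errors. -/
noncomputable def parseStep (q : ParseState) (c : Fin 9) : ParseState :=
  if c = 7 then (q.1, q.2.1, q.2.2.1, q.2.2.2.1 ++ [Dat.nil], q.2.2.2.2)
  else if c = 8 then (q.1, q.2.1, q.2.2.1, q.2.2.2.1 ++ [enc true], q.2.2.2.2)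
  else if c = 5 then (q.1, q.2.1, q.2.2.1, [], true)
  else if c = 6 then
    if q.2.2.2.2 = true then
      if q.2.2.1 = [] then (pushTop (enc (q.2.1 ++ [enc q.2.2.2.1])) q.1, [], [], [], false)
      else (q.1, q.2.1 ++ [enc q.2.2.2.1], q.2.2.1.tail, [], false)
    else (pushTop (enc (q.1.headD [])) q.1.tail, q.2)
  else if c = 3 ∨ c = 4 then ([] :: q.1, q.2)
  else if c = 0 then q
  else (q.1, q.2.1, Dat.nil :: q.2.2.1, q.2.2.2)

/-- Read a string. -/
noncomputable def parse (x : List (Fin 9)) : Dat :=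
  ((x.foldl parseStep ([[]], [], [], [], false)).1.headD []).headD .nil

theorem foldl_parseStep_bits (l : List Dat) (h : ∀ b ∈ l, b = .nil ∨ b = enc true) :
    ∀ (st : List (List Dat)) (cur cnt name : List Dat) (i : Bool),
    (l.map fun b => if b = .nil then (7 : Fin 9) else 8).foldl parseStep (st, cur, cnt, name, i) =
      (st, cur, cnt, name ++ l, i) := by
  induction l with
  | nil => simp
  | cons b l ih =>
    intro st cur cnt name i
    rw [List.map_cons, List.foldl_cons]
    have h1 : parseStep (st, cur, cnt, name, i) (if b = .nil then 7 else 8) =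
        (st, cur, cnt, name ++ [b], i) := by
      rcases h b (by simp) with rfl | rfl <;> simp [parseStep]
    rw [h1, ih fun c hc => h c (by simp [hc])]
    simp

theorem foldl_parseStep_lit {pol x} (h : IsName x) (st : List (List Dat)) (cur cnt : List Dat) :
    (litStr pol x).foldl parseStep (st, cur, cnt, [], false) =
      if cnt = [] then (pushTop (enc (cur ++ [x])) st, [], [], [], false)
      else (st, cur ++ [x], cnt.tail, [], false) := by
  have h0 : (if pol then [] else [0] : List (Fin 9)).foldl parseStep (st, cur, cnt, [], false) =
      (st, cur, cnt, [], false) := by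
    cases pol <;> simp [parseStep]
  have h5 : parseStep (st, cur, cnt, [], false) 5 = (st, cur, cnt, [], true) := by simp [parseStep]
  rw [litStr, List.foldl_append, h0, List.foldl_cons, h5, List.foldl_append,
    foldl_parseStep_bits _ h.1]
  simp [parseStep]

theorem foldl_parseStep_lits {pol} (ls : List Dat) : ∀ (l : Dat), (∀ x ∈ l :: ls, IsName x) →
    ∀ (st : List (List Dat)) (cur cnt : List Dat), cnt.length = ls.length →
    ((l :: ls).flatMap (litStr pol)).foldl parseStep (st, cur, cnt, [], false) =
      (pushTop (enc (cur ++ l :: ls)) st, [], [], [], false) := by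
  induction ls with
  | nil =>
    intro l h st cur cnt hc
    rw [List.flatMap_singleton, foldl_parseStep_lit (h l (by simp)), if_pos (by simpa using hc)]
  | cons a ls ih =>
    intro l h st cur cnt hc
    rw [List.flatMap_cons, List.foldl_append, foldl_parseStep_lit (h l (by simp)),
      if_neg (by rintro rfl; simp at hc), ih a fun x hx => h x (by simp [List.mem_cons.1 hx])]
    · simp
    · simp [hc]

theorem foldl_parseStep_small {α : Type} (op : Bool) (l : List α) :
    ∀ (st : List (List Dat)) (cnt : List Dat), ∃ cnt' : List Dat,
      (l.map fun _ => smallSym op).foldl parseStep (st, [], cnt, [], false) =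
        (st, [], cnt', [], false) ∧ cnt'.length = cnt.length + l.length := by
  induction l with
  | nil => exact fun st cnt => ⟨cnt, rfl, rfl⟩
  | cons a l ih =>
    intro st cnt
    obtain ⟨cnt', h1, h2⟩ := ih st (.nil :: cnt)
    refine ⟨cnt', ?_, by simp [h2]; omega⟩
    rw [List.map_cons, List.foldl_cons, ← h1]
    congr 1
    cases op <;> simp [parseStep, smallSym]

theorem foldl_parseStep_encStr {d pol} : ∀ {s : ℕ} {v : Dat}, Valid d s v →
    ∀ st : List (List Dat), (encStr pol s v).foldl parseStep (st, [], [], [], false) =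
      (pushTop v st, [], [], [], false)
  | 0, v, h, st => by
    rw [encStr, List.foldl_append]
    have h2 := h.2.2
    have h3 := Dat.enc_toList v
    cases hv : v.toList with
    | nil => exact absurd hv h.1
    | cons x l =>
      rw [hv] at h2 h3
      obtain ⟨cnt, h4, h5⟩ := foldl_parseStep_small (isAnd pol 0) l st []
      rw [List.tail_cons, h4, foldl_parseStep_lits l x h2 _ _ _ (by simpa using h5),
        List.nil_append, h3]
  | s + 1, v, h, st => by
    have key : ∀ l : List Dat, (∀ w ∈ l, Valid d s w) → ∀ (top : List Dat) (st : List (List Dat)),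
        (l.flatMap (encStr pol s)).foldl parseStep (top :: st, [], [], [], false) =
          ((top ++ l) :: st, [], [], [], false) := by
      intro l
      induction l with
      | nil => simp
      | cons w l ih =>
        intro hl top st
        rw [List.flatMap_cons, List.foldl_append, foldl_parseStep_encStr (hl w (by simp)),
          pushTop, List.headD_cons, List.tail_cons, ih fun y hy => hl y (by simp [hy])]
        simp
    have h3 : parseStep (st, [], [], [], false) (bigSym (isAnd pol (s + 1))) =
        ([] :: st, [], [], [], false) := by
      cases isAnd pol (s + 1) <;> simp [parseStep, bigSym]
    rw [encStr, List.foldl_cons, h3, List.foldl_append, key _ h]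
    simp [parseStep]

theorem parse_encStr {d pol s} {v : Dat} (h : Valid d s v) : parse (encStr pol s v) = v := by
  rw [parse, foldl_parseStep_encStr h]
  simp [pushTop]

/-! ### Bounded search trees for hitting sets -/

/-- Extend partial hitting sets so that they hit the edge `e`, as long as they have at most `k`
elements; at most `cap` of the results are kept. -/
noncomputable def hitStep (k cap : ℕ) (Hs : List (List Dat)) (e : Dat) : List (List Dat) :=
  (Hs.flatMap fun H => if ∃ x ∈ e.toList, x ∈ H then [H]
    else if H.length < k then e.toList.map fun x => H ++ [x] else []).take cap

/-- A list of hitting sets of the hypergraph `b` such that each hitting set with at most `k`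
elements contains one of them. -/
noncomputable def hits (k cap : ℕ) (b : Dat) : List (List Dat) := b.toList.foldl (hitStep k cap) [[]]

theorem length_le_of_mem_hitStep {k cap : ℕ} {Hs : List (List Dat)} {e : Dat}
    (h : ∀ H ∈ Hs, H.length ≤ k) : ∀ H ∈ hitStep k cap Hs e, H.length ≤ k := by
  intro H hH
  obtain ⟨H', hH', hm⟩ := List.mem_flatMap.1 (List.mem_of_mem_take hH)
  split_ifs at hm with h1 h2
  · rw [List.mem_singleton.1 hm]; exact h H' hH'
  · obtain ⟨x, -, rfl⟩ := List.mem_map.1 hm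
    simp; omega
  · simp at hm

/-- The potential that bounds the size of the search tree. -/
def hitPot (d k : ℕ) (Hs : List (List Dat)) : ℕ := (Hs.map fun H => d ^ (k - H.length)).sum

theorem hitPot_flatMap_le {d k : ℕ} {e : Dat} (he : e.toList.length ≤ d)
    (Hs : List (List Dat)) :
    hitPot d k (Hs.flatMap fun H => if ∃ x ∈ e.toList, x ∈ H then [H]
      else if H.length < k then e.toList.map fun x => H ++ [x] else []) ≤ hitPot d k Hs := by
  induction Hs with
  | nil => simp [hitPot]
  | cons H Hs ih =>
    have h1 : hitPot d k (if ∃ x ∈ e.toList, x ∈ H then [H]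
      else if H.length < k then e.toList.map fun x => H ++ [x] else []) ≤ d ^ (k - H.length) := by
      split_ifs with h1 h2
      · simp [hitPot]
      · have : d ^ (k - H.length) = d * d ^ (k - (H.length + 1)) := by
          rw [← pow_succ']; congr 1; omega
        rw [this]
        simp only [hitPot, List.map_map]
        rw [List.map_congr_left (g := fun _ => d ^ (k - (H.length + 1))) fun x _ => by simp]
        simpa using Nat.mul_le_mul_right _ he
      · simp [hitPot]
    simp only [hitPot, List.flatMap_cons, List.map_append, List.sum_append, List.map_cons,
      List.sum_cons] at h1 ih ⊢
    omega

theorem length_le_hitPot {d k : ℕ} (hd : 1 ≤ d) (Hs : List (List Dat)) :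
    Hs.length ≤ hitPot d k Hs := by
  induction Hs with
  | nil => simp
  | cons H Hs ih =>
    have := Nat.one_le_pow (k - H.length) d hd
    simp only [hitPot, List.length_cons, List.map_cons, List.sum_cons] at ih ⊢
    omega

theorem hits_spec {d k cap : ℕ} (hd : 1 ≤ d) (hcap : d ^ k ≤ cap) {T : Finset Dat}
    (hT : T.card ≤ k) {b : Dat} (hb : ∀ e ∈ b.toList, e.toList.length ≤ d) :
    (∃ H ∈ hits k cap b, ∀ x ∈ H, x ∈ T) ↔ ∀ e ∈ b.toList, ∃ x ∈ e.toList, x ∈ T := by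
  have key : ∀ l : List Dat, (∀ e ∈ l, e.toList.length ≤ d) →
      (hitPot d k (l.foldl (hitStep k cap) [[]]) ≤ d ^ k ∧
      (∀ H ∈ l.foldl (hitStep k cap) [[]], H.Nodup) ∧
      ((∃ H ∈ l.foldl (hitStep k cap) [[]], ∀ x ∈ H, x ∈ T) ↔
        ∀ e ∈ l, ∃ x ∈ e.toList, x ∈ T) ∧
      (∀ H ∈ l.foldl (hitStep k cap) [[]], ∀ e ∈ l, ∃ x ∈ e.toList, x ∈ H)) := by
    intro l
    induction l using List.reverseRecOn with
    | nil => intro _; simp [hitPot]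
    | append_singleton l e ih =>
      intro hl
      obtain ⟨h1, h2, h3, h4⟩ := ih fun e' he' => hl e' (by simp [he'])
      rw [List.foldl_append, List.foldl_cons, List.foldl_nil]
      set Hs := l.foldl (hitStep k cap) [[]]
      have hpot := hitPot_flatMap_le (k := k) (hl e (by simp)) Hs
      have hstep : hitStep k cap Hs e = Hs.flatMap fun H => if ∃ x ∈ e.toList, x ∈ H then [H]
          else if H.length < k then e.toList.map fun x => H ++ [x] else [] :=
        List.take_of_length_le ((length_le_hitPot hd _).trans ((hpot.trans h1).trans hcap))
      rw [hstep]
      have hmem : ∀ H, (H ∈ Hs.flatMap fun H => if ∃ x ∈ e.toList, x ∈ H then [H]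
          else if H.length < k then e.toList.map fun x => H ++ [x] else []) ↔
          ∃ H' ∈ Hs, ((∃ x ∈ e.toList, x ∈ H') ∧ H = H') ∨
            ((¬ ∃ x ∈ e.toList, x ∈ H') ∧ H'.length < k ∧ ∃ x ∈ e.toList, H = H' ++ [x]) := by
        intro H
        rw [List.mem_flatMap]
        refine exists_congr fun H' => and_congr_right fun _ => ?_
        split_ifs with h5 h6
        · simp [h5]
        · simp [h5, h6, eq_comm]
        · simp [h5, h6]
      refine ⟨hpot.trans h1, fun H hH => ?_, ?_, fun H hH => ?_⟩
      · obtain ⟨H', hH', ⟨-, rfl⟩ | ⟨h5, -, x, hx, rfl⟩⟩ := (hmem H).1 hH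
        · exact h2 H hH'
        · refine List.nodup_append.2 ⟨h2 H' hH', by simp, fun y hy z hz => ?_⟩
          rw [List.mem_singleton] at hz
          rintro rfl
          exact h5 ⟨y, hz ▸ hx, hy⟩
      · constructor
        · rintro ⟨H, hH, hHT⟩ e' he'
          obtain ⟨H', hH', h5 | ⟨h5, -, x, hx, rfl⟩⟩ := (hmem H).1 hH
          · obtain ⟨h5, rfl⟩ := h5
            rcases List.mem_append.1 he' with he' | he'
            · obtain ⟨x, hx, hxH⟩ := h4 H hH' e' he'
              exact ⟨x, hx, hHT x hxH⟩
            · obtain ⟨x, hx, hxH⟩ := h5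
              rw [List.mem_singleton.1 he']
              exact ⟨x, hx, hHT x hxH⟩
          · rcases List.mem_append.1 he' with he' | he'
            · obtain ⟨y, hy, hyH⟩ := h4 H' hH' e' he'
              exact ⟨y, hy, hHT y (by simp [hyH])⟩
            · rw [List.mem_singleton.1 he']
              exact ⟨x, hx, hHT x (by simp)⟩
        · intro hall
          obtain ⟨H, hH, hHT⟩ := h3.2 fun e' he' => hall e' (by simp [he'])
          by_cases h5 : ∃ x ∈ e.toList, x ∈ H
          · exact ⟨H, (hmem H).2 ⟨H, hH, .inl ⟨h5, rfl⟩⟩, hHT⟩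
          · obtain ⟨x, hx, hxT⟩ := hall e (by simp)
            refine ⟨H ++ [x], (hmem _).2 ⟨H, hH, .inr ⟨h5, ?_, x, hx, rfl⟩⟩, ?_⟩
            · have hxH : x ∉ H.toFinset := fun h => h5 ⟨x, hx, List.mem_toFinset.1 h⟩
              have := Finset.card_le_card (s := insert x H.toFinset) (t := T) (by
                intro y hy
                rcases Finset.mem_insert.1 hy with rfl | hy
                · exact hxT
                · exact hHT y (List.mem_toFinset.1 hy))
              rw [Finset.card_insert_of_notMem hxH, List.toFinset_card_of_nodup (h2 H hH)] at this
              omega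
            · intro y hy
              rcases List.mem_append.1 hy with hy | hy
              · exact hHT y hy
              · rw [List.mem_singleton.1 hy]; exact hxT
      · obtain ⟨H', hH', h5 | ⟨h5, -, x, hx, rfl⟩⟩ := (hmem H).1 hH
        · obtain ⟨h5, rfl⟩ := h5
          intro e' he'
          rcases List.mem_append.1 he' with he' | he'
          · exact h4 H hH' e' he'
          · rw [List.mem_singleton.1 he']; exact h5
        · intro e' he'
          rcases List.mem_append.1 he' with he' | he'
          · obtain ⟨y, hy, hyH⟩ := h4 H' hH' e' he'
            exact ⟨y, hy, by simp [hyH]⟩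
          · rw [List.mem_singleton.1 he']
            exact ⟨x, hx, by simp⟩
  exact (key _ hb).2.2.1

/-! ### The variables of the reduction -/

/-- The sequences of length at most `k` over `{0, …, k - 1}`, by recursion on the length. -/
def seqs (k : ℕ) : ℕ → List (List ℕ)
  | 0 => [[]]
  | j + 1 => [] :: (seqs k j).flatMap fun P => (List.range k).map fun p => p :: P

theorem mem_seqs {k j : ℕ} {P : List ℕ} : P ∈ seqs k j ↔ P.length ≤ j ∧ ∀ p ∈ P, p < k := by
  induction j generalizing P with
  | zero => cases P <;> simp [seqs]
  | succ j ih =>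
    cases P with
    | nil => simp [seqs]
    | cons p P =>
      simp only [seqs, List.mem_cons, reduceCtorEq, List.mem_flatMap, List.mem_map, List.mem_range,
        false_or, List.cons.injEq, List.length_cons]
      constructor
      · rintro ⟨Q, hQ, q, hq, rfl, rfl⟩
        obtain ⟨h1, h2⟩ := ih.1 hQ
        exact ⟨by omega, by simpa using ⟨hq, h2⟩⟩
      · rintro ⟨h1, h2⟩
        exact ⟨P, ih.2 ⟨by omega, fun x hx => h2 x (.inr hx)⟩, p, h2 p (.inl rfl), rfl, rfl⟩

theorem nodup_seqs (k j : ℕ) : (seqs k j).Nodup := by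
  induction j with
  | zero => simp [seqs]
  | succ j ih =>
    rw [seqs, List.nodup_cons]
    refine ⟨by simp, List.nodup_flatMap.2 ⟨fun P _ => ?_, ?_⟩⟩
    · exact List.nodup_range.map fun p q h => (List.cons.inj h).1
    · refine ih.imp fun {P Q} hPQ => ?_
      simp only [Function.onFun, List.disjoint_left]
      rintro _ h1 h2
      obtain ⟨p, -, rfl⟩ := List.mem_map.1 h1
      obtain ⟨q, -, h3⟩ := List.mem_map.1 h2
      exact hPQ (List.cons.inj h3).2.symm

/-- The variables of the reduction are pairs of a group, which consists of a kind and a sequence of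
positions, and a value, which is a sequence of trees. Exactly one variable of each group is true.
The groups are `(0, [])`, with the disjuncts as values, `(1, [p])` for the positions `p < k`, with
the names of variables as values, and `(2, P)` for the sequences `P` of positions, with the nodes of
the search tree as values. -/
abbrev RVar := (ℕ × List ℕ) × List Dat

/-- The groups. -/
def groups (k : ℕ) (sq : List (List ℕ)) : List (ℕ × List ℕ) :=
  (0, []) :: ((List.range k).map (fun p => (1, [p])) ++ sq.map fun P => (2, P))

theorem nodup_groups (k j : ℕ) : (groups k (seqs k j)).Nodup := by
  rw [groups, List.nodup_cons]
  refine ⟨by simp, List.nodup_append.2 ⟨?_, ?_, ?_⟩⟩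
  · exact List.nodup_range.map fun p q h => by simpa using h
  · exact (nodup_seqs k j).map fun p q h => by simpa using h
  · intro a ha b hb
    obtain ⟨p, -, rfl⟩ := List.mem_map.1 ha
    obtain ⟨q, -, rfl⟩ := List.mem_map.1 hb
    simp

/-- The variables for the nodes `w` of the search tree in `l` and the sequences `P` in `sq`. -/
def nodeVars (sq : List (List ℕ)) (l : List (List Dat)) : List RVar :=
  sq.flatMap fun P => (l.filter fun w => decide (w.length ≤ P.length)).map fun w => ((2, P), w)

theorem mem_nodeVars {sq : List (List ℕ)} {l : List (List Dat)} {u : RVar} :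
    u ∈ nodeVars sq l ↔ ∃ P ∈ sq, ∃ w ∈ l, w.length ≤ P.length ∧ u = ((2, P), w) := by
  simp [nodeVars, eq_comm, and_assoc]

/-- All nodes of the search trees of the hypergraphs in `l`. -/
noncomputable def nodes (k cap : ℕ) (l : List Dat) : List (List Dat) :=
  [] :: l.flatMap fun b => (hits k cap b).flatMap fun H =>
    (List.range (H.length + 1)).map fun i => H.take i

theorem take_mem_nodes {k cap : ℕ} {l : List Dat} {b : Dat} (hb : b ∈ l) {H : List Dat}
    (hH : H ∈ hits k cap b) (i : ℕ) : H.take i ∈ nodes k cap l := by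
  refine List.mem_cons_of_mem _ (List.mem_flatMap.2 ⟨b, hb, List.mem_flatMap.2 ⟨H, hH,
    List.mem_map.2 ⟨min i H.length, by simp, ?_⟩⟩⟩)
  rcases le_total i H.length with h | h
  · rw [min_eq_left h]
  · rw [min_eq_right h, List.take_length, List.take_of_length_le h]

/-- All variables of the reduction: `as` are the disjuncts, `ns` the names of variables, and `W` the
nodes of the search trees. -/
def allVars (k : ℕ) (sq : List (List ℕ)) (as ns : List Dat) (W : List (List Dat)) : List RVar :=
  as.map (fun a => ((0, []), [a])) ++
    ((List.range k).flatMap (fun p => ns.map fun x => ((1, [p]), [x])) ++ nodeVars sq W)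

/-- The pairs of variables that are not both true. -/
def Conflict (W : List (List Dat)) (u u' : RVar) : Prop :=
  (u.1 = u'.1 ∧ u.2 ≠ u'.2) ∨
  (u.1.1 = 1 ∧ u'.1.1 = 1 ∧ u.1 ≠ u'.1 ∧ u.2 = u'.2) ∨
  (u.1.1 = 2 ∧ u'.1.1 = 1 ∧
    ((∃ z ∈ u.1.2.zip u.2, [z.1] = u'.1.2 ∧ [z.2] ≠ u'.2) ∨
      ((u.1.2.drop u.2.length).take 1 = u'.1.2 ∧ u.2 ++ u'.2 ∈ W)))

/-- If the variables in `τ` are free of conflicts and select the elements `s p` then the true node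
variables tell which of the hypergraphs are hit by these elements. -/
theorem exists_nodeVar_iff {k cap d : ℕ} (hd : 1 ≤ d) (hcap : d ^ k ≤ cap) {l : List Dat}
    {τ : Finset RVar} {s : ℕ → Dat} (hs : Set.InjOn s {p | p < k})
    (hsel : ∀ p < k, ((1, [p]), [s p]) ∈ τ)
    (hnode : ∀ P ∈ seqs k k, ∃ w ∈ nodes k cap l, w.length ≤ P.length ∧ ((2, P), w) ∈ τ)
    (hconf : ∀ u ∈ τ, ∀ u' ∈ τ, ¬ Conflict (nodes k cap l) u u') {b : Dat} (hb : b ∈ l)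
    (hbd : ∀ e ∈ b.toList, e.toList.length ≤ d) :
    (∃ u ∈ nodeVars (seqs k k) (hits k cap b), u ∈ τ) ↔
      ∀ e ∈ b.toList, ∃ x ∈ e.toList, x ∈ (Finset.range k).image s := by
  have hcard : ((Finset.range k).image s).card = k := by
    rw [Finset.card_image_of_injOn (by simpa [Set.InjOn] using hs), Finset.card_range]
  have hzip : ∀ P ∈ seqs k k, ∀ w, ((2, P), w) ∈ τ → ∀ z ∈ P.zip w, z.2 = s z.1 := by
    intro P hP w hw z hz
    by_contra hne
    refine hconf _ hw _ (hsel z.1 ((mem_seqs.1 hP).2 _ (List.of_mem_zip hz).1))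
      (.inr (.inr ⟨rfl, rfl, .inl ⟨z, hz, rfl, ?_⟩⟩))
    simpa using hne
  have hget : ∀ P ∈ seqs k k, ∀ w, ((2, P), w) ∈ τ → w.length ≤ P.length →
      w = (P.map s).take w.length := by
    intro P hP w hw hlen
    refine List.ext_getElem (by simp [hlen]) fun i h1 h2 => ?_
    have h3 : i < (P.zip w).length := by simp; omega
    have := hzip P hP w hw _ (List.getElem_mem h3)
    simpa using this
  rw [← hits_spec hd hcap hcard.le hbd]
  constructor
  · rintro ⟨u, hu, huτ⟩
    obtain ⟨P, hP, H, hH, hlen, rfl⟩ := mem_nodeVars.1 hu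
    refine ⟨H, hH, fun x hx => ?_⟩
    rw [hget P hP H huτ hlen] at hx
    obtain ⟨p, hp, rfl⟩ := List.mem_map.1 (List.mem_of_mem_take hx)
    exact Finset.mem_image_of_mem _ (Finset.mem_range.2 ((mem_seqs.1 hP).2 p hp))
  · rintro ⟨H, hH, hHT⟩
    have hlenk : H.length ≤ k := by
      have : ∀ l : List Dat, ∀ H ∈ l.foldl (hitStep k cap) [[]], H.length ≤ k := by
        intro l
        induction l using List.reverseRecOn with
        | nil => simp
        | append_singleton l e ih =>
          rw [List.foldl_append]
          exact length_le_of_mem_hitStep ih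
      exact this _ H hH
    obtain ⟨P, hPk, hPH⟩ : ∃ P : List ℕ, (∀ p ∈ P, p < k) ∧ P.map s = H := by
      clear hH hlenk
      induction H with
      | nil => exact ⟨[], by simp, rfl⟩
      | cons x H ih =>
        obtain ⟨P, h1, h2⟩ := ih fun y hy => hHT y (by simp [hy])
        obtain ⟨p, hp, rfl⟩ := Finset.mem_image.1 (hHT x (by simp))
        exact ⟨p :: P, by simpa using ⟨Finset.mem_range.1 hp, h1⟩, by simp [h2]⟩
    have hPlen : P.length = H.length := by rw [← hPH, List.length_map]
    have hP : P ∈ seqs k k := mem_seqs.2 ⟨by omega, hPk⟩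
    obtain ⟨w, -, hwlen, hwτ⟩ := hnode P hP
    have hw := hget P hP w hwτ hwlen
    rw [hPH] at hw
    have hlt : ¬ w.length < P.length := by
      intro hlt
      refine hconf _ hwτ _ (hsel P[w.length] (hPk _ (List.getElem_mem hlt)))
        (.inr (.inr ⟨rfl, rfl, .inr ⟨?_, ?_⟩⟩))
      · simp only
        rw [List.drop_eq_getElem_cons hlt, List.take_succ_cons, List.take_zero]
      · have : w ++ [s P[w.length]] = H.take (w.length + 1) := by
          rw [List.take_add_one, ← hw, ← hPH]
          simp [hlt]
        simp only
        rw [this]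
        exact take_mem_nodes hb hH _
    have hwH : w = H := by
      rw [hw, List.take_of_length_le (by omega)]
    exact ⟨_, mem_nodeVars.2 ⟨P, hP, H, hH, by omega, rfl⟩, hwH ▸ hwτ⟩

theorem mem_allVars {k : ℕ} {sq : List (List ℕ)} {as ns : List Dat} {W : List (List Dat)}
    {u : RVar} : u ∈ allVars k sq as ns W ↔ (∃ a ∈ as, u = ((0, []), [a])) ∨
      (∃ p < k, ∃ x ∈ ns, u = ((1, [p]), [x])) ∨
      ∃ P ∈ sq, ∃ w ∈ W, w.length ≤ P.length ∧ u = ((2, P), w) := by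
  simp [allVars, mem_nodeVars, eq_comm]

theorem mem_groups {k : ℕ} {sq : List (List ℕ)} {g : ℕ × List ℕ} :
    g ∈ groups k sq ↔ g = (0, []) ∨ (∃ p < k, g = (1, [p])) ∨ ∃ P ∈ sq, g = (2, P) := by
  simp [groups, eq_comm]

theorem exists_image_range_eq {k : ℕ} {T : Finset Dat} (hT : T.card = k) :
    ∃ s : ℕ → Dat, Set.InjOn s {p | p < k} ∧ (Finset.range k).image s = T := by
  have hlen : T.toList.length = k := by simpa using hT
  refine ⟨fun p => T.toList.getD p .nil, fun p hp q hq hpq => ?_, ?_⟩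
  · simp only [Set.mem_ofPred_eq, ← hlen] at hp hq
    simp only [List.getD_eq_getElem _ _ hp, List.getD_eq_getElem _ _ hq] at hpq
    exact (List.Nodup.getElem_inj_iff T.nodup_toList).1 hpq
  · ext x
    rw [Finset.mem_image, ← Finset.mem_toList, List.mem_iff_getElem]
    constructor
    · rintro ⟨p, hp, rfl⟩
      rw [Finset.mem_range, ← hlen] at hp
      exact ⟨p, hp, (List.getD_eq_getElem _ _ hp).symm⟩
    · rintro ⟨p, hp, rfl⟩
      exact ⟨p, by rwa [Finset.mem_range, ← hlen], List.getD_eq_getElem _ _ hp⟩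

/-- Weighted satisfiability of the source expressed by the variables of the reduction. Here
`Sem T a` says that `T` satisfies the disjunct `a`, and `Res τ a` that `τ` satisfies its
translation. -/
theorem exists_card_iff {k cap d : ℕ} (hd : 1 ≤ d) (hcap : d ^ k ≤ cap) {as ns l : List Dat}
    (hl : ∀ b ∈ l, ∀ e ∈ b.toList, e.toList.length ≤ d) {Sem : Finset Dat → Dat → Prop}
    {Res : Finset RVar → Dat → Prop}
    (hsem : ∀ T ⊆ ns.toFinset, ∀ τ, (∀ b ∈ l, (∃ u ∈ nodeVars (seqs k k) (hits k cap b), u ∈ τ) ↔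
      ∀ e ∈ b.toList, ∃ x ∈ e.toList, x ∈ T) → ∀ a ∈ as, (Res τ a ↔ Sem T a)) :
    (∃ T ⊆ ns.toFinset, T.card = k ∧ ∃ a ∈ as, Sem T a) ↔
      ∃ τ ⊆ (allVars k (seqs k k) as ns (nodes k cap l)).toFinset,
        τ.card = (groups k (seqs k k)).length ∧
        (∀ u ∈ τ, ∀ u' ∈ τ, ¬ Conflict (nodes k cap l) u u') ∧
        ∀ a ∈ as, ((0, []), [a]) ∈ τ → Res τ a := by
  constructor
  · rintro ⟨T, hTn, hTk, a, ha, hSem⟩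
    obtain ⟨s, hs, rfl⟩ := exists_image_range_eq hTk
    have hw : ∀ P : List ℕ, ∃ j ≤ P.length, (P.map s).take j ∈ nodes k cap l ∧
        (j < P.length → (P.map s).take (j + 1) ∉ nodes k cap l) := by
      classical
      intro P
      have h0 : (P.map s).take 0 ∈ nodes k cap l := by simp [nodes]
      refine ⟨Nat.findGreatest (fun j => (P.map s).take j ∈ nodes k cap l) P.length,
        Nat.findGreatest_le _, Nat.findGreatest_spec (P := fun j => (P.map s).take j ∈ nodes k cap l)
          (Nat.zero_le _) h0, fun hj => ?_⟩
      exact Nat.findGreatest_is_greatest (Nat.lt_succ_self _) hj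
    choose j hj1 hj2 hj3 using hw
    let val : ℕ × List ℕ → List Dat := fun g =>
      if g.1 = 0 then [a] else if g.1 = 1 then g.2.map s else (g.2.map s).take (j g.2)
    let τ : Finset RVar := (groups k (seqs k k)).toFinset.image fun g => (g, val g)
    have hmem : ∀ u, u ∈ τ ↔ u.1 ∈ groups k (seqs k k) ∧ u.2 = val u.1 := by
      rintro ⟨g, x⟩
      simp only [τ, Finset.mem_image, List.mem_toFinset, Prod.mk.injEq]
      constructor
      · rintro ⟨g, hg, rfl, rfl⟩; exact ⟨hg, rfl⟩
      · rintro ⟨hg, rfl⟩; exact ⟨g, hg, rfl, rfl⟩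
    have hconf : ∀ u ∈ τ, ∀ u' ∈ τ, ¬ Conflict (nodes k cap l) u u' := by
      rintro ⟨g, x⟩ hu ⟨g', x'⟩ hu' hc
      rw [hmem] at hu hu'
      dsimp only at hu hu'
      obtain ⟨hg, rfl⟩ := hu
      obtain ⟨hg', rfl⟩ := hu'
      rcases hc with ⟨h1, h2⟩ | ⟨h1, h2, h3, h4⟩ | ⟨h1, h2, h3⟩
      · simp only at h1 h2
        exact h2 (by rw [h1])
      · rw [mem_groups] at hg hg'
        obtain rfl | ⟨p, hp, rfl⟩ | ⟨P, -, rfl⟩ := hg <;> simp at h1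
        obtain rfl | ⟨q, hq, rfl⟩ | ⟨P, -, rfl⟩ := hg' <;> simp at h2
        simp only [val, one_ne_zero, if_false, if_true, List.map_cons, List.map_nil,
          List.cons.injEq, and_true] at h4
        exact h3 (by rw [hs hp hq h4])
      · rw [mem_groups] at hg hg'
        obtain rfl | ⟨p, hp, rfl⟩ | ⟨P, -, rfl⟩ := hg <;> simp at h1
        obtain rfl | ⟨p, hp, rfl⟩ | ⟨P', -, rfl⟩ := hg' <;> simp at h2
        simp only [val, one_ne_zero, if_false, if_true, OfNat.ofNat_ne_zero, OfNat.ofNat_ne_one,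
          List.map_cons, List.map_nil] at h3
        rcases h3 with ⟨z, hz, h4, h5⟩ | ⟨h4, h5⟩
        · obtain ⟨i, hi, rfl⟩ := List.mem_iff_getElem.1 hz
          simp at h4 h5
          exact h5 (by rw [h4])
        · have hlen : ((P.map s).take (j P)).length = j P := by simp [hj1]
          rw [hlen] at h4
          have hlt : j P < P.length := by
            by_contra hge
            rw [List.drop_eq_nil_of_le (by omega)] at h4
            simp at h4
          rw [List.drop_eq_getElem_cons hlt, List.take_succ_cons, List.take_zero] at h4
          refine hj3 P hlt ?_
          rw [List.take_add_one]
          simpa [hlt, (List.cons.inj h4).1] using h5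
    refine ⟨τ, ?_, ?_, hconf, ?_⟩
    · intro u hu
      obtain ⟨hg, h2⟩ := (hmem u).1 hu
      obtain ⟨g, x⟩ := u
      simp only at hg h2
      subst h2
      rw [List.mem_toFinset, mem_allVars]
      obtain rfl | ⟨p, hp, rfl⟩ | ⟨P, hP, rfl⟩ := mem_groups.1 hg
      · exact .inl ⟨a, ha, rfl⟩
      · exact .inr (.inl ⟨p, hp, s p, List.mem_toFinset.1 (hTn (Finset.mem_image_of_mem s
          (Finset.mem_range.2 hp))), rfl⟩)
      · refine .inr (.inr ⟨P, hP, _, hj2 P, ?_, rfl⟩)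
        simp
    · rw [Finset.card_image_of_injective _ fun g g' h => (Prod.ext_iff.1 h).1,
        List.toFinset_card_of_nodup (nodup_groups k k)]
    · intro a' ha' hτ
      have h1 := ((hmem _).1 hτ).2
      simp only [val, if_true, List.cons.injEq, and_true] at h1
      subst h1
      refine (hsem _ hTn τ (fun b hb => ?_) a' ha').2 hSem
      refine exists_nodeVar_iff hd hcap hs (fun p hp => ?_) (fun P hP => ?_) hconf hb (hl b hb)
      · exact (hmem _).2 ⟨mem_groups.2 (.inr (.inl ⟨p, hp, rfl⟩)), rfl⟩
      · exact ⟨_, hj2 P, by simp, (hmem _).2 ⟨mem_groups.2 (.inr (.inr ⟨P, hP, rfl⟩)), rfl⟩⟩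
  · rintro ⟨τ, hτ, hcard, hconf, hres⟩
    have hinj : Set.InjOn Prod.fst (τ : Set RVar) := fun u hu u' hu' h => by
      by_contra hne
      exact hconf u hu u' hu' (.inl ⟨h, fun h2 => hne (Prod.ext h h2)⟩)
    have hgr : τ.image Prod.fst = (groups k (seqs k k)).toFinset := by
      refine Finset.eq_of_subset_of_card_le (fun g hg => ?_) ?_
      · obtain ⟨u, hu, rfl⟩ := Finset.mem_image.1 hg
        rw [List.mem_toFinset, mem_groups]
        rcases mem_allVars.1 (List.mem_toFinset.1 (hτ hu)) with ⟨a, -, rfl⟩ | ⟨p, hp, x, -, rfl⟩ |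
          ⟨P, hP, w, -, -, rfl⟩
        · exact .inl rfl
        · exact .inr (.inl ⟨p, hp, rfl⟩)
        · exact .inr (.inr ⟨P, hP, rfl⟩)
      · rw [Finset.card_image_of_injOn hinj, hcard, List.toFinset_card_of_nodup (nodup_groups k k)]
    have hex : ∀ g ∈ groups k (seqs k k), ∃ x, (g, x) ∈ τ := by
      intro g hg
      rw [← List.mem_toFinset, ← hgr] at hg
      obtain ⟨u, hu, rfl⟩ := Finset.mem_image.1 hg
      exact ⟨u.2, hu⟩
    obtain ⟨x, hx⟩ := hex (0, []) (mem_groups.2 (.inl rfl))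
    obtain ⟨a, ha, rfl⟩ : ∃ a ∈ as, x = [a] := by
      have := mem_allVars.1 (List.mem_toFinset.1 (hτ hx))
      simpa using this
    have hsel : ∀ p, ∃ x, p < k → x ∈ ns ∧ ((1, [p]), [x]) ∈ τ := by
      intro p
      by_cases hp : p < k
      · obtain ⟨y, hy⟩ := hex (1, [p]) (mem_groups.2 (.inr (.inl ⟨p, hp, rfl⟩)))
        have := mem_allVars.1 (List.mem_toFinset.1 (hτ hy))
        simp only [Prod.mk.injEq, one_ne_zero, false_and, and_false, exists_false, false_or,
          OfNat.one_ne_ofNat, or_false, true_and, List.cons.injEq, and_true] at this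
        obtain ⟨q, -, x, hx, -, rfl⟩ := this
        exact ⟨x, fun _ => ⟨hx, hy⟩⟩
      · exact ⟨.nil, fun h => absurd h hp⟩
    choose s hs using hsel
    have hsinj : Set.InjOn s {p | p < k} := by
      intro p hp q hq hpq
      by_contra hne
      exact hconf _ (hs p hp).2 _ (hs q hq).2 (.inr (.inl ⟨rfl, rfl, by simpa using hne, by simp [hpq]⟩))
    have hTn : (Finset.range k).image s ⊆ ns.toFinset := by
      intro y hy
      obtain ⟨p, hp, rfl⟩ := Finset.mem_image.1 hy
      exact List.mem_toFinset.2 (hs p (Finset.mem_range.1 hp)).1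
    refine ⟨_, hTn, ?_, a, ha, ?_⟩
    · rw [Finset.card_image_of_injOn (by simpa [Set.InjOn] using hsinj), Finset.card_range]
    · refine (hsem _ hTn τ (fun b hb => ?_) a ha).1 (hres a ha hx)
      refine exists_nodeVar_iff hd hcap hsinj (fun p hp => (hs p hp).2) (fun P hP => ?_) hconf hb
        (hl b hb)
      obtain ⟨w, hw⟩ := hex (2, P) (mem_groups.2 (.inr (.inr ⟨P, hP, rfl⟩)))
      have := mem_allVars.1 (List.mem_toFinset.1 (hτ hw))
      simp only [Prod.mk.injEq, OfNat.ofNat_ne_zero, OfNat.ofNat_ne_one, false_and, and_false,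
        exists_false, false_or, true_and] at this
      obtain ⟨P', -, w', hw', hlen, rfl, rfl⟩ := this
      exact ⟨w, hw', hlen, hw⟩

theorem exists_mem_map {α β : Type} {l : List α} {f : α → β} {p : β → Prop} :
    (∃ b ∈ l.map f, p b) ↔ ∃ a ∈ l, p (f a) := by simp

theorem Fml.sat_big_map_congr {c : Bool} {l : List Dat} {f g : Dat → Fml} {S S' : Finset ℕ}
    (h : ∀ a ∈ l, ((f a).Sat S' ↔ (g a).Sat S)) :
    (big c (l.map f)).Sat S' ↔ (big c (l.map g)).Sat S := by
  cases c
  · rw [sat_big_false, sat_big_false, exists_mem_map, exists_mem_map]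
    exact exists_congr fun a => and_congr_right fun ha => h a ha
  · rw [sat_big_true, sat_big_true, List.forall_mem_map, List.forall_mem_map]
    exact forall₂_congr h

/-! ### The formula of the reduction -/

/-- The index of a variable of the reduction. -/
def varIdx (u : RVar) : ℕ := ofBits ((enc u).code ++ [true])

theorem bits_varIdx (u : RVar) : (varIdx u).bits = (enc u).code ++ [true] :=
  bits_ofBits (by simp)

theorem varIdx_injective : Function.Injective varIdx := fun u u' h => by
  have := congrArg Nat.bits h
  rw [bits_varIdx, bits_varIdx] at this
  exact DatEnc.inj (Dat.code_injective (List.append_cancel_right this))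

/-- The hypergraphs in a tree that represents a formula of level `j + 2`. -/
def hypergraphs : ℕ → Dat → List Dat
  | 0, a => a.toList
  | j + 1, a => a.toList.flatMap (hypergraphs j)

theorem Valid.of_mem_hypergraphs {d : ℕ} : ∀ {j : ℕ} {a : Dat}, Valid d (j + 2) a →
    ∀ b ∈ hypergraphs j a, Valid d 1 b
  | 0, _, h, b, hb => h b hb
  | j + 1, a, h, b, hb => by
    obtain ⟨w, hw, hb⟩ := List.mem_flatMap.1 hb
    exact (h w hw).of_mem_hypergraphs b hb

theorem mem_leaves_of_mem_hypergraphs : ∀ {j : ℕ} {a b e x : Dat}, b ∈ hypergraphs j a →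
    e ∈ b.toList → x ∈ e.toList → x ∈ leaves (j + 2) a
  | 0, a, b, e, x, hb, he, hx =>
    List.mem_flatMap.2 ⟨b, hb, List.mem_flatMap.2 ⟨e, he, hx⟩⟩
  | j + 1, a, b, e, x, hb, he, hx => by
    obtain ⟨w, hw, hb⟩ := List.mem_flatMap.1 hb
    exact List.mem_flatMap.2 ⟨w, hw, mem_leaves_of_mem_hypergraphs hb he hx⟩

section

variable (pol : Bool) (k cap : ℕ) (sq : List (List ℕ))

/-- The arguments of the outermost connective of the translation of a formula of level `j + 2`. -/
noncomputable def outArgs : ℕ → Dat → List Fml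
  | 0, a => a.toList.flatMap fun b =>
      (nodeVars sq (hits k cap b)).map fun u => lit pol (varIdx u)
  | j + 1, a => a.toList.map fun a' => big (isAnd pol (j + 2)) (outArgs j a')

/-- The clause that excludes the conflicting variables `u` and `u'`. -/
noncomputable def pairClause (W : List (List Dat)) (u u' : RVar) : Fml :=
  open Classical in
  .or (.neg (.var (varIdx u))) (if Conflict W u u' then .neg (.var (varIdx u')) else .var (varIdx u))

/-- The argument `x` of the disjunct `a`, to be satisfied only if `a` is selected. -/
noncomputable def guarded (a : Dat) (x : Fml) : Fml :=
  .or (.neg (.var (varIdx ((0, []), [a])))) x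

/-- The nodes of the search trees of all hypergraphs in a formula of level `m + 3`. -/
noncomputable def nodesOf (m : ℕ) (v : Dat) : List (List Dat) := nodes k cap (hypergraphs (m + 1) v)

/-- The variables of the translation of a formula of level `m + 3`. -/
noncomputable def varsOf (m : ℕ) (v : Dat) : List RVar :=
  allVars k sq v.toList (leaves (m + 3) v) (nodesOf k cap m v)

/-- The translation of a formula of level `m + 3`. -/
noncomputable def outFml (m : ℕ) (v : Dat) : Fml :=
  big true ((varsOf k cap sq m v).flatMap (fun u => (varsOf k cap sq m v).map
    (pairClause (nodesOf k cap m v) u)) ++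
    v.toList.flatMap fun a => (outArgs pol k cap sq m a).map (guarded a))

theorem mem_nodeVars_hypergraphs {l : List Dat} {b : Dat} (hb : b ∈ l) {u : RVar}
    (hu : u ∈ nodeVars sq (hits k cap b)) : u ∈ nodeVars sq (nodes k cap l) := by
  obtain ⟨P, hP, H, hH, hlen, rfl⟩ := mem_nodeVars.1 hu
  refine mem_nodeVars.2 ⟨P, hP, H, ?_, hlen, rfl⟩
  simpa using take_mem_nodes hb hH H.length

theorem vars_outArgs : ∀ {j : ℕ} {a : Dat} {x : Fml} {n : ℕ}, x ∈ outArgs pol k cap sq j a →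
    n ∈ x.vars → ∃ b ∈ hypergraphs j a, ∃ u ∈ nodeVars sq (hits k cap b), varIdx u = n
  | 0, a, x, n, hx, hn => by
    obtain ⟨b, hb, hx⟩ := List.mem_flatMap.1 hx
    obtain ⟨u, hu, rfl⟩ := List.mem_map.1 hx
    rw [vars_lit, Finset.mem_singleton] at hn
    exact ⟨b, hb, u, hu, hn.symm⟩
  | j + 1, a, x, n, hx, hn => by
    obtain ⟨a', ha', rfl⟩ := List.mem_map.1 hx
    obtain ⟨y, hy, hn⟩ := mem_vars_big.1 hn
    obtain ⟨b, hb, h⟩ := vars_outArgs hy hn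
    exact ⟨b, List.mem_flatMap.2 ⟨a', ha', hb⟩, h⟩

theorem weft_depth_outArgs : ∀ {j : ℕ} {a : Dat} {x : Fml}, x ∈ outArgs pol k cap sq j a →
    x.weft ≤ j ∧ x.depth ≤ j
  | 0, a, x, hx => by
    obtain ⟨b, -, hx⟩ := List.mem_flatMap.1 hx
    obtain ⟨u, -, rfl⟩ := List.mem_map.1 hx
    cases pol <;> simp [lit, weft, depth]
  | j + 1, a, x, hx => by
    obtain ⟨a', -, rfl⟩ := List.mem_map.1 hx
    exact ⟨weft_big_le fun y hy => (weft_depth_outArgs hy).1,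
      depth_big_le fun y hy => (weft_depth_outArgs hy).2⟩

theorem outFml_mem_Omega (m : ℕ) (v : Dat) : outFml pol k cap sq m v ∈ Omega (m + 1) (m + 2) := by
  have h : ∀ x ∈ (varsOf k cap sq m v).flatMap (fun u => (varsOf k cap sq m v).map
      (pairClause (nodesOf k cap m v) u)) ++
      v.toList.flatMap (fun a => (outArgs pol k cap sq m a).map (guarded a)),
      x.weft ≤ m ∧ x.depth ≤ m + 1 := by
    intro x hx
    rcases List.mem_append.1 hx with hx | hx
    · obtain ⟨u, -, hx⟩ := List.mem_flatMap.1 hx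
      obtain ⟨u', -, rfl⟩ := List.mem_map.1 hx
      unfold pairClause
      split_ifs <;> simp [weft, depth]
    · obtain ⟨a, -, hx⟩ := List.mem_flatMap.1 hx
      obtain ⟨y, hy, rfl⟩ := List.mem_map.1 hx
      obtain ⟨h1, h2⟩ := weft_depth_outArgs pol k cap sq hy
      simpa [guarded, weft, depth] using ⟨h1, h2⟩
  exact ⟨weft_big_le fun x hx => (h x hx).1, depth_big_le fun x hx => (h x hx).2⟩

theorem vars_outFml (m : ℕ) (v : Dat) :
    (outFml pol k cap sq m v).vars = (varsOf k cap sq m v).toFinset.image varIdx := by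
  ext n
  rw [outFml, mem_vars_big, Finset.mem_image]
  constructor
  · rintro ⟨x, hx, hn⟩
    rcases List.mem_append.1 hx with hx | hx
    · obtain ⟨u, hu, hx⟩ := List.mem_flatMap.1 hx
      obtain ⟨u', hu', rfl⟩ := List.mem_map.1 hx
      unfold pairClause at hn
      split_ifs at hn
      · simp only [vars, Finset.mem_union, Finset.mem_singleton] at hn
        rcases hn with rfl | rfl
        · exact ⟨u, List.mem_toFinset.2 hu, rfl⟩
        · exact ⟨u', List.mem_toFinset.2 hu', rfl⟩
      · simp only [vars, Finset.mem_union, Finset.mem_singleton, or_self] at hn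
        exact ⟨u, List.mem_toFinset.2 hu, hn.symm⟩
    · obtain ⟨a, ha, hx⟩ := List.mem_flatMap.1 hx
      obtain ⟨y, hy, rfl⟩ := List.mem_map.1 hx
      simp only [guarded, vars, Finset.mem_union, Finset.mem_singleton] at hn
      rcases hn with rfl | hn
      · exact ⟨_, List.mem_toFinset.2 (List.mem_append_left _ (List.mem_map.2 ⟨a, ha, rfl⟩)), rfl⟩
      · obtain ⟨b, hb, u, hu, rfl⟩ := vars_outArgs pol k cap sq hy hn
        exact ⟨u, List.mem_toFinset.2 (List.mem_append_right _ (List.mem_append_right _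
          (mem_nodeVars_hypergraphs k cap sq (List.mem_flatMap.2 ⟨a, ha, hb⟩) hu))), rfl⟩
  · rintro ⟨u, hu, rfl⟩
    rw [List.mem_toFinset] at hu
    exact ⟨_, List.mem_append_left _ (List.mem_flatMap.2 ⟨u, hu, List.mem_map.2 ⟨u, hu, rfl⟩⟩),
      by simp [pairClause, vars]⟩

theorem sat_outFml (m : ℕ) (v : Dat) {τ : Finset RVar} (hτ : τ ⊆ (varsOf k cap sq m v).toFinset) :
    (outFml pol k cap sq m v).Sat (τ.image varIdx) ↔
      (∀ u ∈ τ, ∀ u' ∈ τ, ¬ Conflict (nodesOf k cap m v) u u') ∧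
      ∀ a ∈ v.toList, ((0, []), [a]) ∈ τ → ∀ x ∈ outArgs pol k cap sq m a,
        x.Sat (τ.image varIdx) := by
  have hmem : ∀ u, varIdx u ∈ τ.image varIdx ↔ u ∈ τ := fun u => by
    simp [varIdx_injective.eq_iff]
  rw [outFml, sat_big_true, List.forall_mem_append]
  refine and_congr ?_ ?_
  · constructor
    · intro h u hu u' hu' hc
      have := h _ (List.mem_flatMap.2 ⟨u, List.mem_toFinset.1 (hτ hu),
        List.mem_map.2 ⟨u', List.mem_toFinset.1 (hτ hu'), rfl⟩⟩)
      rw [pairClause, if_pos hc] at this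
      simp only [Sat, hmem] at this
      tauto
    · intro h x hx
      obtain ⟨u, -, hx⟩ := List.mem_flatMap.1 hx
      obtain ⟨u', -, rfl⟩ := List.mem_map.1 hx
      unfold pairClause
      split_ifs with hc
      · simp only [Sat, hmem]
        by_contra hcon
        push Not at hcon
        exact h u hcon.1 u' hcon.2 hc
      · simp only [Sat]; tauto
  · constructor
    · intro h a ha haτ x hx
      have := h _ (List.mem_flatMap.2 ⟨a, ha, List.mem_map.2 ⟨x, hx, rfl⟩⟩)
      simp only [guarded, Sat, hmem] at this
      tauto
    · intro h x hx
      obtain ⟨a, ha, hx⟩ := List.mem_flatMap.1 hx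
      obtain ⟨y, hy, rfl⟩ := List.mem_map.1 hx
      simp only [guarded, Sat, hmem]
      have := fun h1 => h a ha h1 y hy
      tauto

theorem kSat_outFml (m K : ℕ) (v : Dat) : (outFml pol k cap sq m v).KSat K ↔
    ∃ τ ⊆ (varsOf k cap sq m v).toFinset, τ.card = K ∧
      (∀ u ∈ τ, ∀ u' ∈ τ, ¬ Conflict (nodesOf k cap m v) u u') ∧
      ∀ a ∈ v.toList, ((0, []), [a]) ∈ τ → ∀ x ∈ outArgs pol k cap sq m a,
        x.Sat (τ.image varIdx) := by
  unfold KSat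
  rw [vars_outFml]
  simp only [Finset.subset_image_iff]
  constructor
  · rintro ⟨_, ⟨τ, hτ, rfl⟩, hk, hS⟩
    rw [Finset.card_image_of_injective _ varIdx_injective] at hk
    exact ⟨τ, hτ, hk, (sat_outFml pol k cap sq m v hτ).1 hS⟩
  · rintro ⟨τ, hτ, hk, hS⟩
    exact ⟨_, ⟨τ, hτ, rfl⟩, by rwa [Finset.card_image_of_injective _ varIdx_injective],
      (sat_outFml pol k cap sq m v hτ).2 hS⟩

theorem sat_outArgs {d : ℕ} {S S' : Finset ℕ} : ∀ {j : ℕ} {a : Dat}, Valid d (j + 2) a →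
    (∀ b ∈ hypergraphs j a, (∃ u ∈ nodeVars sq (hits k cap b), varIdx u ∈ S') ↔
      ∀ e ∈ b.toList, ∃ x ∈ e.toList, nameIdx x ∈ S) →
    ((big (isAnd pol (j + 2)) (outArgs pol k cap sq j a)).Sat S' ↔ (toFml pol (j + 2) a).Sat S)
  | 0, a, h, H => by
    have h1 : ∀ b ∈ a.toList, (toFml pol 1 b).Sat S ↔
        ((∃ u ∈ nodeVars sq (hits k cap b), varIdx u ∈ S') ↔ pol = true) := by
      intro b hb
      rw [sat_toFml_one (h b hb), H b hb]
    have h2 : ∀ b u, u ∈ nodeVars sq (hits k cap b) → b ∈ a.toList →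
        lit pol (varIdx u) ∈ outArgs pol k cap sq 0 a := fun b u hu hb =>
      List.mem_flatMap.2 ⟨b, hb, List.mem_map.2 ⟨u, hu, rfl⟩⟩
    rw [toFml]
    cases pol
    · rw [show isAnd false (1 + 1) = true from rfl,
        sat_big_true, sat_big_true, List.forall_mem_map]
      simp only [Bool.false_eq_true, iff_false] at h1
      constructor
      · intro h3 b hb
        rw [h1 b hb]
        rintro ⟨u, hu, huS⟩
        simpa [sat_lit, huS] using h3 _ (h2 b u hu hb)
      · intro h3 x hx
        obtain ⟨b, hb, hx⟩ := List.mem_flatMap.1 hx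
        obtain ⟨u, hu, rfl⟩ := List.mem_map.1 hx
        have := (h1 b hb).1 (h3 b hb)
        rw [sat_lit]
        simpa using fun huS => this ⟨u, hu, huS⟩
    · rw [show isAnd true (1 + 1) = false from rfl,
        sat_big_false, sat_big_false, exists_mem_map]
      simp only [iff_true] at h1
      constructor
      · rintro ⟨x, hx, hS⟩
        obtain ⟨b, hb, hx⟩ := List.mem_flatMap.1 hx
        obtain ⟨u, hu, rfl⟩ := List.mem_map.1 hx
        exact ⟨b, hb, (h1 b hb).2 ⟨u, hu, by simpa [sat_lit] using hS⟩⟩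
      · rintro ⟨b, hb, hS⟩
        obtain ⟨u, hu, huS⟩ := (h1 b hb).1 hS
        exact ⟨_, h2 b u hu hb, by simpa [sat_lit] using huS⟩
  | j + 1, a, h, H => by
    have h1 : ∀ a' ∈ a.toList, ((big (isAnd pol (j + 2)) (outArgs pol k cap sq j a')).Sat S' ↔
        (toFml pol (j + 2) a').Sat S) := fun a' ha' =>
      sat_outArgs (h a' ha') fun b hb => H b (List.mem_flatMap.2 ⟨a', ha', hb⟩)
    rw [toFml, outArgs]
    exact sat_big_map_congr h1

/-- The translation preserves weighted satisfiability. -/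
theorem kSat_toFml_iff_outFml {d m : ℕ} (hd : 1 ≤ d) (hcap : d ^ k ≤ cap) {v : Dat}
    (hv : Valid d (m + 3) v) (hpol : isAnd pol (m + 3) = false) :
    (toFml pol (m + 3) v).KSat k ↔
      (outFml pol k cap (seqs k k) m v).KSat (groups k (seqs k k)).length := by
  have hpol' : isAnd pol (m + 2) = true := by simpa [isAnd] using hpol
  rw [kSat_toFml hv hpol, kSat_outFml]
  have hval : ∀ b ∈ hypergraphs (m + 1) v, Valid d 1 b := hv.of_mem_hypergraphs
  refine exists_card_iff hd hcap (fun b hb e he => (hval b hb e he).2.1)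
    (Sem := fun T a => (toFml pol (m + 2) a).Sat (T.image nameIdx))
    (Res := fun τ a => ∀ x ∈ outArgs pol k cap (seqs k k) m a, x.Sat (τ.image varIdx))
    fun T hT τ hτ a ha => ?_
  rw [← sat_outArgs pol k cap (seqs k k) (S := T.image nameIdx) (S' := τ.image varIdx) (hv a ha),
    hpol', sat_big_true]
  intro b hb
  have hb' : b ∈ hypergraphs (m + 1) v := List.mem_flatMap.2 ⟨a, ha, hb⟩
  simp only [Finset.mem_image, varIdx_injective.eq_iff, exists_eq_right]
  rw [hτ b hb']
  refine forall₂_congr fun e he => exists_congr fun x => and_congr_right fun hx => ?_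
  constructor
  · exact fun h => ⟨x, h, rfl⟩
  · rintro ⟨y, hy, hxy⟩
    have hx' := mem_leaves_of_mem_hypergraphs hb' he hx
    rwa [← nameIdx_injOn hv (List.mem_toFinset.1 (hT hy)) hx' hxy]

end

/-! ### The cost of reading and checking the input -/

section

variable {C : (ℕ → ℕ) → Prop} [CostClass C]
variable {α β : Type} [DatEnc α] [DatEnc β]

theorem Cmp.headD {f : α → List β} {b : β} (hf : Cmp C f) : Cmp C (fun a => (f a).headD b) := by
  convert listRec (g := fun _ => b) (h := fun _ x _ => x) hf (const _) (fst snd') using 2 with a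
  cases f a <;> rfl

theorem cmp_parseStep : Cmp C (fun q : ParseState × Fin 9 => parseStep q.1 q.2) := by
  have hc (i : Fin 9) : CmpPred C (fun q : ParseState × Fin 9 => q.2 = i) :=
    .eq .snd' (.const _)
  have h1 : Cmp C (fun q : ParseState × Fin 9 => q.1.1) := .fst .fst'
  have h2 : Cmp C (fun q : ParseState × Fin 9 => q.1.2.1) := .fst (.snd .fst')
  have h3 : Cmp C (fun q : ParseState × Fin 9 => q.1.2.2.1) := .fst (.snd (.snd .fst'))
  have h4 : Cmp C (fun q : ParseState × Fin 9 => q.1.2.2.2.1) := .fst (.snd (.snd (.snd .fst')))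
  have h5 : Cmp C (fun q : ParseState × Fin 9 => q.1.2.2.2.2) := .snd (.snd (.snd (.snd .fst')))
  have h6 : Cmp C (fun q : ParseState × Fin 9 => q.1.2.1 ++ [enc q.1.2.2.2.1]) :=
    .append h2 (.singleton (.enc h4))
  have hpush {f : ParseState × Fin 9 → Dat} {g : ParseState × Fin 9 → List (List Dat)}
      (hf : Cmp C f) (hg : Cmp C g) : Cmp C (fun q => pushTop (f q) (g q)) :=
    .cons (.append (.headD hg) (.singleton hf)) (.tail hg)
  refine .ite' (hc 7) (.pair h1 (.pair h2 (.pair h3 (.pair (.append h4 (.const _)) h5)))) ?_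
  refine .ite' (hc 8) (.pair h1 (.pair h2 (.pair h3 (.pair (.append h4 (.const _)) h5)))) ?_
  refine .ite' (hc 5) (.pair h1 (.pair h2 (.pair h3 (.const _)))) ?_
  refine .ite' (hc 6) ?_ ?_
  · refine .ite' (.eq_true h5) (.ite' (.eq_nil h3) ?_ ?_) ?_
    · exact .pair (hpush (.enc h6) h1) (.const _)
    · exact .pair h1 (.pair h6 (.pair (.tail h3) (.const _)))
    · exact .pair (hpush (.enc (.headD h1)) (.tail h1)) (.snd .fst')
  refine .ite' (.or (hc 3) (hc 4)) (.pair (.cons .nil h1) (.snd .fst')) ?_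
  exact .ite' (hc 0) .fst' (.pair h1 (.pair h2 (.pair (.cons (.const _) h3) (.snd (.snd (.snd .fst'))))))

theorem sz_pushTop (x : Dat) (st : List (List Dat)) : sz (pushTop x st) ≤ sz st + sz x + 2 := by
  cases st with
  | nil => simp [pushTop]
  | cons => simp [pushTop, sz_append]; omega

theorem sz_enc (a : α) : sz (enc a) = sz a := rfl

theorem sz_headD_tail (st : List (List Dat)) : sz (st.headD []) + sz st.tail ≤ sz st := by
  cases st <;> simp

theorem sz_tail_le (l : List α) : sz l.tail ≤ sz l := by
  cases l <;> simp; omega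

theorem sz_parseStep (q : ParseState) (c : Fin 9) : sz (parseStep q c) ≤ sz q + 10 := by
  obtain ⟨st, cur, cnt, name, i⟩ := q
  have h0 : sz Dat.nil = 0 := rfl
  have h1 := sz_pushTop (enc (cur ++ [enc name])) st
  have h2 := sz_pushTop (enc (st.headD [])) st.tail
  have h3 := sz_headD_tail st
  have h4 := sz_tail_le cnt
  have h5 := sz_bool_le i
  have h6 : sz (enc true) = 1 := rfl
  simp only [sz_enc, sz_append, sz_cons, sz_nil] at h1 h2
  unfold parseStep
  split_ifs <;> simp only [sz_pair, sz_append, sz_cons, sz_nil, sz_true, sz_false, sz_enc, h0, h6] <;>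
    omega

theorem cmp_parse : Cmp C parse := by
  have : Cmp C (fun x : List (Fin 9) => x.foldl parseStep ([[]], [], [], [], false)) :=
    .foldl_of_add (st := fun _ => parseStep) .id (.const _) (cmp_parseStep.comp .snd')
      (CostClass.const 10) fun _ q c _ => sz_parseStep q c
  exact .headD (.headD (.fst this))

theorem cmp_litStr (pol : Bool) : Cmp C (litStr pol) := by
  refine .append (.const _) (.cons (.const _) (.append (.map (.toList .id) ?_) (.const _)))
  exact .ite' (.eq .snd' (.const _)) (.const _) (.const _)

theorem cmp_encStr (pol : Bool) : ∀ s, Cmp C (encStr pol s)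
  | 0 => .append (.map (.tail (.toList .id)) (.const _))
      (.flatMap (.toList .id) ((cmp_litStr pol).comp .snd'))
  | s + 1 => .cons (.const _) (.append (.flatMap (.toList .id) ((cmp_encStr pol s).comp .snd'))
      (.const _))

theorem cmpPred_isName : CmpPred C IsName := by
  refine .and (.forall_mem (.toList .id) (p := fun _ b => b = .nil ∨ b = enc true)
    (.or (.eq .snd' (.const _)) (.eq .snd' (.const _)))) ?_
  exact .not (.eq (.take (.const 1) (.reverse (.toList .id))) (.const _))

theorem cmpPred_valid (d : ℕ) : ∀ s, CmpPred C (Valid d s)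
  | 0 => .and (.not (.eq_nil (.toList .id))) (.and (.le (.length (.toList .id)) (.const d))
      (.forall_mem (.toList .id) (p := fun _ x => IsName x) (cmpPred_isName.comp .snd')))
  | s + 1 => .forall_mem (.toList .id) (p := fun _ x => Valid d s x)
      ((cmpPred_valid d s).comp .snd')

theorem cmp_leaves : ∀ s, Cmp C (leaves s)
  | 0 => .toList .id
  | s + 1 => .flatMap (.toList .id) ((cmp_leaves s).comp .snd')

theorem cmp_hypergraphs : ∀ j, Cmp C (hypergraphs j)
  | 0 => .toList .id
  | j + 1 => .flatMap (.toList .id) ((cmp_hypergraphs j).comp .snd')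

/-! ### The cost of writing the output -/

theorem cmp_hits : Cmp C (fun q : (ℕ × ℕ) × Dat => hits q.1.1 q.1.2 q.2) := by
  classical
  have hst : Cmp C (fun q : ((ℕ × ℕ) × Dat) × List (List Dat) × Dat =>
      hitStep q.1.1.1 q.1.1.2 q.2.1 q.2.2) := by
    refine .take (.snd (.fst .fst')) (.flatMap (.fst .snd') (.ite' ?_ (.singleton .snd')
      (.ite' ?_ (.map (.toList (.snd (.snd .fst'))) ?_) .nil)))
    · exact .exists_mem (.toList (.snd (.snd .fst')))
        (p := fun (q : (((ℕ × ℕ) × Dat) × List (List Dat) × Dat) × List Dat) x => x ∈ q.2)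
        (.mem .snd' (.snd .fst'))
    · exact .lt (.length .snd') (.fst (.fst (.fst .fst')))
    · exact .append (.snd .fst') (.singleton .snd')
  refine Cmp.foldl (l := fun q : (ℕ × ℕ) × Dat => q.2.toList)
    (st := fun q => hitStep q.1.1 q.1.2) (i := fun _ => [[]]) (.toList .snd') (.const _) hst
    (b := fun n => (n + 1) * (n * (n + 1) + 1)) ?_ ?_
  · exact CostClass.mul (CostClass.add CostClass.id (CostClass.const 1)) (CostClass.add
      (CostClass.mul CostClass.id (CostClass.add CostClass.id (CostClass.const 1)))
      (CostClass.const 1))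
  · rintro ⟨⟨k, cap⟩, b⟩ l hl
    have key : (l.foldl (hitStep k cap) [[]]).length ≤ cap + 1 ∧
        ∀ H ∈ l.foldl (hitStep k cap) [[]], H.length ≤ k ∧ ∀ x ∈ H, sz x ≤ sz b := by
      replace hl : ∀ e ∈ l, e ∈ b.toList := fun e he => hl.subset he
      induction l using List.reverseRecOn with
      | nil => simp
      | append_singleton l e ih =>
        obtain ⟨-, ih2⟩ := ih fun e' he' => hl e' (by simp [he'])
        rw [List.foldl_append, List.foldl_cons, List.foldl_nil]
        refine ⟨(List.length_take_le _ _).trans (Nat.le_succ _), fun H hH =>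
          ⟨length_le_of_mem_hitStep (fun H hH => (ih2 H hH).1) H hH, ?_⟩⟩
        obtain ⟨H', hH', hm⟩ := List.mem_flatMap.1 (List.mem_of_mem_take hH)
        split_ifs at hm with h1 h2
        · rw [List.mem_singleton.1 hm]; exact (ih2 H' hH').2
        · obtain ⟨x, hx, rfl⟩ := List.mem_map.1 hm
          intro y hy
          rcases List.mem_append.1 hy with hy | hy
          · exact (ih2 H' hH').2 y hy
          · rw [List.mem_singleton.1 hy]
            have h3 : sz e.toList = sz e := congrArg Dat.size (Dat.enc_toList e)
            have h4 : sz b.toList = sz b := congrArg Dat.size (Dat.enc_toList b)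
            exact ((sz_le_of_mem hx).trans h3.le).trans
              ((sz_le_of_mem (hl e (by simp))).trans h4.le)
        · simp at hm
    have hn : sz ((k, cap), b) = k + cap + 1 + sz b + 1 := by simp
    refine (sz_le_of_forall (c := k * (sz b + 1)) fun H hH => ?_).trans ?_
    · exact (sz_le_of_forall (key.2 H hH).2).trans (Nat.mul_le_mul_right _ (key.2 H hH).1)
    · rw [hn]
      exact Nat.mul_le_mul (key.1.trans (by omega)) (Nat.succ_le_succ
        (Nat.mul_le_mul (by omega) (by omega)))

theorem cmp_nodeVars : Cmp C (fun q : List (List ℕ) × List (List Dat) => nodeVars q.1 q.2) := by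
  refine .flatMap .fst' (.map (.filter (.snd .fst') 
    (p := fun (q : (List (List ℕ) × List (List Dat)) × List ℕ) w => w.length ≤ q.2.length)
    (.le (.length .snd') (.length (.snd .fst')))) ?_)
  exact .pair (.pair (.const _) (.snd .fst')) .snd'

theorem cmp_nodes : Cmp C (fun q : (ℕ × ℕ) × List Dat => nodes q.1.1 q.1.2 q.2) := by
  refine .cons .nil (.flatMap .snd' (.flatMap ?_ (.map (.range (.add (.length .snd') (.const 1)))
    (.take .snd' (.snd .fst')))))
  exact cmp_hits.comp (f := fun q : ((ℕ × ℕ) × List Dat) × Dat => (q.1.1, q.2))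
    (.pair (.fst .fst') .snd')

theorem cmpPred_conflict {W : α → List (List Dat)} {u u' : α → RVar} (hW : Cmp C W) (hu : Cmp C u)
    (hu' : Cmp C u') : CmpPred C (fun a => Conflict (W a) (u a) (u' a)) := by
  refine .or (.and (.eq (.fst hu) (.fst hu')) (.not (.eq (.snd hu) (.snd hu')))) (.or ?_ ?_)
  · exact .and (.eq (.fst (.fst hu)) (.const _)) (.and (.eq (.fst (.fst hu')) (.const _))
      (.and (.not (.eq (.fst hu) (.fst hu'))) (.eq (.snd hu) (.snd hu'))))
  · refine .and (.eq (.fst (.fst hu)) (.const _)) (.and (.eq (.fst (.fst hu')) (.const _))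
      (.or (.exists_mem (.zip (.snd (.fst hu)) (.snd hu))
        (p := fun a z => [z.1] = (u' a).1.2 ∧ [z.2] ≠ (u' a).2) (.and ?_ (.not ?_))) (.and ?_ ?_)))
    · exact .eq (.singleton (.fst .snd')) (.snd (.fst (hu'.comp .fst')))
    · exact .eq (.singleton (.snd .snd')) (.snd (hu'.comp .fst'))
    · exact .eq (.take (.const 1) (.drop (.length (.snd hu)) (.snd (.fst hu)))) (.snd (.fst hu'))
    · exact .mem (.append (.snd hu) (.snd hu')) hW

theorem cmp_encode_var {u : α → RVar} (hu : Cmp C u) :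
    Cmp C (fun a => (var (varIdx (u a))).encode) := by
  simp only [encode_var, bits_varIdx]
  refine .cons (.const _) (.append (.map (.append (.code (.enc hu)) (.const _)) ?_) (.const _))
  exact .ite' (.eq_true .snd') (.const _) (.const _)

theorem cmp_encode_neg {f : α → Fml} (hf : Cmp C (fun a => (f a).encode)) :
    Cmp C (fun a => (neg (f a)).encode) := by
  simp only [encode]
  exact .cons (.const _) hf

theorem cmp_encode_or {f g : α → Fml} (hf : Cmp C (fun a => (f a).encode))
    (hg : Cmp C (fun a => (g a).encode)) : Cmp C (fun a => (Fml.or (f a) (g a)).encode) := by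
  simp only [encode]
  exact .append (.cons (.const _) hf) hg

theorem cmp_encode_lit (pol : Bool) {u : α → RVar} (hu : Cmp C u) :
    Cmp C (fun a => (lit pol (varIdx (u a))).encode) := by
  cases pol
  · exact cmp_encode_neg (cmp_encode_var hu)
  · exact cmp_encode_var hu

theorem cmp_encode_big (c : Bool) {f : α → List Fml} (hf : Cmp C (fun a => (f a).map encode)) :
    Cmp C (fun a => (big c (f a)).encode) := by
  simp only [encode_big, List.flatMap]
  exact .cons (.const _) (.append (.flatten hf) (.const _))

open Classical in
theorem cmp_encode_ite {p : α → Prop} {f g : α → Fml} (hp : CmpPred C p)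
    (hf : Cmp C (fun a => (f a).encode)) (hg : Cmp C (fun a => (g a).encode)) :
    Cmp C (fun a => (if p a then f a else g a).encode) := by
  convert Cmp.ite' hp hf hg using 2 with a
  split_ifs <;> rfl

/-- The part of the data of the reduction that depends on the parameter only: the parameter, the
bound on the size of search trees and the sequences of positions. -/
abbrev Env := (ℕ × ℕ) × List (List ℕ)

theorem cmp_outArgs (pol : Bool) : ∀ j, Cmp C (fun q : Env × Dat =>
    (outArgs pol q.1.1.1 q.1.1.2 q.1.2 j q.2).map encode)
  | 0 => by
    simp only [outArgs, List.map_flatMap, List.map_map]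
    refine .flatMap (.toList .snd') (.map ?_ (cmp_encode_lit pol .snd'))
    refine cmp_nodeVars.comp (f := fun q : (Env × Dat) × Dat =>
      (q.1.1.2, hits q.1.1.1.1 q.1.1.1.2 q.2)) (.pair (.snd (.fst .fst')) ?_)
    exact cmp_hits.comp (f := fun q : (Env × Dat) × Dat => (q.1.1.1, q.2))
      (.pair (.fst (.fst .fst')) .snd')
  | j + 1 => by
    simp only [outArgs, List.map_map]
    refine .map (.toList .snd') (cmp_encode_big _ (f := fun q : (Env × Dat) × Dat =>
      outArgs pol q.1.1.1.1 q.1.1.1.2 q.1.1.2 j q.2) ?_)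
    exact (cmp_outArgs pol j).comp (f := fun q : (Env × Dat) × Dat => (q.1.1, q.2))
      (.pair (.fst .fst') .snd')

theorem cmp_nodesOf (m : ℕ) : Cmp C (fun q : Env × Dat => nodesOf q.1.1.1 q.1.1.2 m q.2) :=
  cmp_nodes.comp (f := fun q : Env × Dat => (q.1.1, hypergraphs (m + 1) q.2))
    (.pair (.fst .fst') ((cmp_hypergraphs (m + 1)).comp .snd'))

theorem cmp_varsOf (m : ℕ) : Cmp C (fun q : Env × Dat => varsOf q.1.1.1 q.1.1.2 q.1.2 m q.2) := by
  refine .append (.map (.toList .snd') (.pair (.const _) (.singleton .snd')))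
    (.append (.flatMap (.range (.fst (.fst .fst'))) (.map ?_ ?_)) ?_)
  · exact (cmp_leaves (m + 3)).comp (.snd .fst')
  · exact .pair (.pair (.const _) (.singleton (.snd .fst'))) (.singleton .snd')
  · exact cmp_nodeVars.comp (f := fun q : Env × Dat => (q.1.2, nodesOf q.1.1.1 q.1.1.2 m q.2))
      (.pair (.snd .fst') (cmp_nodesOf m))

theorem cmp_encode_outFml (pol : Bool) (m : ℕ) : Cmp C (fun q : Env × Dat =>
    (outFml pol q.1.1.1 q.1.1.2 q.1.2 m q.2).encode) := by
  refine cmp_encode_big _ ?_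
  simp only [List.map_append, List.map_flatMap, List.map_map]
  refine .append (.flatMap (cmp_varsOf m) (.map ((cmp_varsOf m).comp .fst') ?_))
    (.flatMap (.toList .snd') ?_)
  · refine cmp_encode_or (cmp_encode_neg (cmp_encode_var (.snd .fst'))) (cmp_encode_ite ?_ ?_ ?_)
    · exact cmpPred_conflict ((cmp_nodesOf m).comp (.fst .fst')) (.snd .fst') .snd'
    · exact cmp_encode_neg (cmp_encode_var .snd')
    · exact cmp_encode_var (.snd .fst')
  · have h1 : Cmp C (fun q : (Env × Dat) × Dat => (outArgs pol q.1.1.1.1 q.1.1.1.2 q.1.1.2 m q.2).map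
        encode) := (cmp_outArgs pol m).comp (f := fun q : (Env × Dat) × Dat => (q.1.1, q.2))
      (.pair (.fst .fst') .snd')
    have h2 := Cmp.map (g := fun (q : (Env × Dat) × Dat) (w : List (Fin 9)) =>
      2 :: ((neg (var (varIdx ((0, []), [q.2])))).encode ++ w)) h1 (.cons (.const _) (.append
        (cmp_encode_neg (cmp_encode_var (.pair (.const _) (.singleton (.snd .fst'))))) .snd'))
    have h3 (a : Dat) : encode ∘ guarded a = (fun w : List (Fin 9) =>
        2 :: ((neg (var (varIdx ((0, []), [a])))).encode ++ w)) ∘ encode := by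
      funext x
      simp [guarded, encode]
    simp only [List.map_map] at h2
    simp only [h3]
    exact h2

end

/-! ### The data that depend on the parameter -/

/-- The binary representation of a number as a string over the alphabet `{0, 1}`. -/
def bitStr (n : ℕ) : List (Fin 2) := n.bits.map fun b => if b then 1 else 0

/-- The value of a binary number. -/
def bitVal (y : List (Fin 2)) : ℕ := 
  y.reverse.foldl (fun (n : ℕ) (c : Fin 2) => n + n + (c : ℕ)) 0

theorem bitVal_bitStr (n : ℕ) : bitVal (bitStr n) = n := by
  have h : ∀ l : List Bool, bitVal (l.map fun b => if b then 1 else 0) = ofBits l := by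
    intro l
    induction l with
    | nil => rfl
    | cons b l ih =>
      unfold bitVal at ih
      rw [bitVal, List.map_cons, List.reverse_cons, List.foldl_append, ih]
      cases b <;> simp [ofBits, Nat.bit, two_mul]
  rw [bitStr, h, ofBits_bits]

theorem bitStr_injective : Function.Injective bitStr := fun m n h => by
  rw [← bitVal_bitStr m, h, bitVal_bitStr]

/-- Add a carry to a binary number. -/
def addCarry : List Bool → Bool → List Bool
  | [], c => if c = true then [true] else []
  | b :: l, c => (if b = c then false else true) :: addCarry l (if b = true then c else false)

theorem addCarry_false (l : List Bool) : addCarry l false = l := by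
  induction l with
  | nil => rfl
  | cons b l ih => cases b <;> simp [addCarry, ih]

theorem bits_succ (n : ℕ) : (n + 1).bits = addCarry n.bits true := by
  induction n using Nat.binaryRec' with
  | zero => simp [addCarry]
  | bit b n h ih =>
    rw [Nat.bits_append_bit _ _ h]
    cases b
    · have : Nat.bit false n + 1 = Nat.bit true n := by simp [Nat.bit]
      rw [this, Nat.bits_append_bit _ _ (by simp)]
      simp [addCarry, addCarry_false]
    · have : Nat.bit true n + 1 = Nat.bit false (n + 1) := by simp [Nat.bit]; omega
      rw [this, Nat.bits_append_bit _ _ (by simp), ih]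
      simp [addCarry]

theorem cmp_addCarry : Cmp RecCost (fun l => addCarry l true) := by
  have key : ∀ (l o : List Bool) (c : Bool),
      (l.foldl (fun q b => (q.1 ++ [if b = q.2 then false else true],
        if b = true then q.2 else false)) (o, c)).1 ++
      (if (l.foldl (fun q b => (q.1 ++ [if b = q.2 then false else true],
        if b = true then q.2 else false)) (o, c)).2 = true then [true] else []) =
      o ++ addCarry l c := by
    intro l
    induction l with
    | nil => intro o c; simp [addCarry]
    | cons b l ih => intro o c; rw [List.foldl_cons, ih, addCarry]; simp
  have h1 : Cmp RecCost (fun l : List Bool => l.foldl (fun (q : List Bool × Bool) b =>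
      (q.1 ++ [if b = q.2 then false else true], if b = true then q.2 else false)) ([], true)) := by
    refine .foldl_rec (st := fun _ (q : List Bool × Bool) b =>
      (q.1 ++ [if b = q.2 then false else true], if b = true then q.2 else false)) .id (.const _)
      (.pair (.append (.fst (.fst .snd')) (.singleton (.ite' (.eq (.snd .snd')
        (.snd (.fst .snd'))) (.const _) (.const _)))) (.ite' (.eq_true (.snd .snd'))
        (.snd (.fst .snd')) (.const _)))
  have := Cmp.append (Cmp.fst h1) (Cmp.ite' (.eq_true (Cmp.snd h1)) (.const [true]) (.const []))
  simpa only [key, List.nil_append] using this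

theorem cmp_bitStr : Cmp RecCost bitStr := by
  have h1 : Cmp RecCost Nat.bits := by
    have := Cmp.foldl_rec (l := fun n : ℕ => List.replicate n Dat.nil)
      (st := fun _ (acc : List Bool) _ => addCarry acc true) (i := fun _ => []) (.unary .id)
      (.const _) (cmp_addCarry.comp (.fst .snd'))
    convert this using 2 with n
    induction n with
    | zero => simp
    | succ n ih => rw [bits_succ, ih, List.replicate_succ', List.foldl_append]; rfl
  exact .map h1 (.ite' (.eq_true .snd') (.const _) (.const _))

theorem cmp_bitVal : Cmp RecCost bitVal :=
  .foldl_rec (st := fun _ n (c : Fin 2) => n + n + (c : ℕ)) (.reverse .id) (.const 0)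
    (.add (.add (.fst .snd') (.fst .snd')) (.of_enc (.snd .snd') fun _ => rfl))

theorem cmp_seqs : Cmp RecCost (fun k => seqs k k) := by
  have := Cmp.foldl_rec (l := fun n : ℕ => List.replicate n Dat.nil)
    (st := fun k (acc : List (List ℕ)) _ => [] :: acc.flatMap fun P =>
      (List.range k).map fun p => p :: P) (i := fun _ => [[]]) (.unary .id) (.const _)
    (.cons .nil (.flatMap (.fst .snd') (.map (.range (.fst .fst')) (.cons .snd' (.snd .fst')))))
  have key : ∀ k j, seqs k j = (List.replicate j Dat.nil).foldl (fun acc _ =>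
      [] :: acc.flatMap fun P => (List.range k).map fun p => p :: P) [[]] := by
    intro k j
    induction j with
    | zero => rfl
    | succ j ih => rw [seqs, ih, List.replicate_succ', List.foldl_append]; rfl
  simpa only [← key] using this

theorem cmp_pow (d : ℕ) : Cmp RecCost (fun k => d ^ k) := by
  have := Cmp.foldl_rec (l := fun n : ℕ => List.replicate n Dat.nil)
    (st := fun _ acc _ => acc * d) (i := fun _ => 1) (.unary .id) (.const _)
    (.mul (.fst .snd') (.const d))
  convert this using 2 with k
  induction k with
  | zero => rfl
  | succ k ih => rw [pow_succ, ih, List.replicate_succ', List.foldl_append]; rfl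

/-- The data of the reduction that depend on the parameter `k`: the environment, the new parameter,
and whether the parameter is well-formed. -/
noncomputable def paramData (d : ℕ) (y : List (Fin 2)) : Env × List (Fin 2) × Bool :=
  let k := bitVal y
  (((k, d ^ k), seqs k k), bitStr (k + (seqs k k).length + 1),
    @decide (bitStr k = y) (Classical.dec _))

theorem cmp_paramData (d : ℕ) : Cmp RecCost (paramData d) := by
  refine .pair (.pair (.pair cmp_bitVal ((cmp_pow d).comp cmp_bitVal)) (cmp_seqs.comp cmp_bitVal))
    (.pair (cmp_bitStr.comp ?_) (CmpPred.eq (cmp_bitStr.comp cmp_bitVal) .id))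
  exact .add (.add cmp_bitVal (.length (cmp_seqs.comp cmp_bitVal))) (.const 1)

theorem length_groups (k : ℕ) (sq : List (List ℕ)) : (groups k sq).length = k + sq.length + 1 := by
  simp [groups]

/-! ### The reduction -/

open Classical in
/-- The reduction, given the data that depend on the parameter. -/
noncomputable def reduce (pol : Bool) (m d : ℕ)
    (w : List (Fin 9) × Env × List (Fin 2) × Bool) : List (Fin 9) × List (Fin 2) :=
  if w.2.2.2 = true ∧ Valid d (m + 3) (parse w.1) ∧ encStr pol (m + 3) (parse w.1) = w.1 then
    ((outFml pol w.2.1.1.1 w.2.1.1.2 w.2.1.2 m (parse w.1)).encode, w.2.2.1)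
  else ([], [])

open Classical in
theorem cmp_reduce (pol : Bool) (m d : ℕ) : Cmp PolyCost (reduce pol m d) := by
  have hp : Cmp PolyCost (fun w : List (Fin 9) × Env × List (Fin 2) × Bool => parse w.1) :=
    cmp_parse.comp .fst'
  refine .ite' (.and (.eq_true (.snd (.snd .snd'))) (.and ((cmpPred_valid d (m + 3)).comp hp)
    (.eq ((cmp_encStr pol (m + 3)).comp hp) .fst'))) (.pair ?_ (.fst (.snd .snd'))) (.const _)
  exact (cmp_encode_outFml pol m).comp (f := fun w : List (Fin 9) × Env × List (Fin 2) × Bool =>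
    (w.2.1, parse w.1)) (.pair (.fst .snd') hp)

theorem wSat_mem_W (pol : Bool) (m d : ℕ) (hd : 1 ≤ d) (hpol : isAnd pol (m + 3) = false) :
    WSat (DeltaClass (litSet pol) d (m + 3)) ∈ W (m + 1) := by
  have hclass : ∀ α, α ∈ DeltaClass (litSet pol) d (m + 3) ↔
      ∃ v, Valid d (m + 3) v ∧ toFml pol (m + 3) v = α := by
    intro α
    simpa [hpol] using mem_class_iff (d := d) (pol := pol) (m + 3) α
  refine ⟨_, ⟨m + 2, Nat.le_succ _, rfl⟩, fun w => reduce pol m d (w.1, paramData d w.2), ?_, ?_,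
    fptComputable_of_cmp (cmp_paramData d) (cmp_reduce pol m d)⟩
  · intro x y
    constructor
    · rintro ⟨α, hα, k, hk, hw⟩
      obtain ⟨v, hv, rfl⟩ := (hclass α).1 hα
      obtain ⟨rfl, rfl⟩ := Prod.mk.inj hw
      change reduce pol m d ((toFml pol (m + 3) v).encode, paramData d (bitStr k)) ∈ _
      have hparse : parse (toFml pol (m + 3) v).encode = v := by
        rw [encode_toFml hv, parse_encStr hv]
      refine ⟨outFml pol k (d ^ k) (seqs k k) m v, outFml_mem_Omega ..,
        (groups k (seqs k k)).length, (kSat_toFml_iff_outFml pol k (d ^ k) hd le_rfl hv hpol).1 hk, ?_⟩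
      rw [reduce, if_pos ⟨by simp [paramData, bitVal_bitStr], by rwa [hparse],
        by rw [hparse, encode_toFml hv]⟩]
      simp only [paramData, hparse, bitVal_bitStr, length_groups]
      rfl
    · intro h
      change reduce pol m d (x, paramData d y) ∈ _ at h
      rw [reduce] at h
      split_ifs at h with hc
      · obtain ⟨β, -, K, hK, hw⟩ := h
        obtain ⟨h1, h2⟩ := Prod.mk.inj hw
        have hy : bitStr (bitVal y) = y := by simpa [paramData] using hc.1
        rw [← encode_injective h1] at hK
        rw [← bitStr_injective h2] at hK
        refine ⟨toFml pol (m + 3) (parse x), (hclass _).2 ⟨_, hc.2.1, rfl⟩, bitVal y, ?_, ?_⟩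
        · refine (kSat_toFml_iff_outFml pol _ (d ^ bitVal y) hd le_rfl hc.2.1 hpol).2 ?_
          rw [length_groups]
          exact hK
        · rw [encode_toFml hc.2.1, hc.2.2]
          exact congrArg _ hy.symm
      · obtain ⟨β, -, K, -, hw⟩ := h
        have h1 := (Prod.mk.inj hw).1
        cases β <;> simp [encode] at h1
  · obtain ⟨b, hb, hb'⟩ := (cmp_paramData d).exists_bound
    refine ⟨fun n => b (2 * n), (hb.2.comp (Primrec.nat_mul.comp (.const 2) .id)).to_comp,
      fun x y => ?_⟩
    change (reduce pol m d (x, paramData d y)).2.length ≤ _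
    have h1 : (reduce pol m d (x, paramData d y)).2.length ≤ (paramData d y).2.1.length := by
      rw [reduce]
      split_ifs <;> simp
    have h2 := length_le_sz (paramData d y).2.1
    have h3 : sz (paramData d y).2.1 ≤ sz (paramData d y) := by
      obtain ⟨e, z, ok⟩ := paramData d y
      simp only [sz_pair]
      omega
    exact ((h1.trans h2).trans h3).trans ((hb' y).trans (hb.1 (sz_str_le y)))

theorem litSet_true : litSet true = posLit := rfl

theorem litSet_false : litSet false = negLit := rfl

theorem isAnd_add_two (pol : Bool) (s : ℕ) : isAnd pol (s + 2) = isAnd pol s := by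
  simp [isAnd]

theorem isAnd_two_mul (pol : Bool) (s : ℕ) : isAnd pol (2 * s) = !pol := by
  induction s with
  | zero => rfl
  | succ s ih => rw [Nat.mul_succ, isAnd_add_two, ih]

theorem mainTheorem8 (t d : ℕ) (ht : 1 ≤ t) (hd : 1 ≤ d) :
    WSat (DeltaNeg (2 * t + 1) d) ∈ W (2 * t - 1) ∧
      WSat (DeltaPos (2 * t + 2) d) ∈ W (2 * t) := by
  obtain ⟨s, rfl⟩ : ∃ s, t = s + 1 := ⟨t - 1, by omega⟩
  constructor
  · have := wSat_mem_W false (2 * s) d hd (by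
      rw [show 2 * s + 3 = 2 * (s + 1) + 1 by ring, isAnd, isAnd_two_mul]; rfl)
    rwa [litSet_false, show 2 * s + 3 = 2 * (s + 1) + 1 by ring] at this
  · have := wSat_mem_W true (2 * s + 1) d hd (by
      rw [show 2 * s + 1 + 3 = 2 * (s + 2) by ring, isAnd_two_mul]; rfl)
    rwa [litSet_true, show 2 * s + 1 + 3 = 2 * (s + 1) + 2 by ring] at this
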